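/- Let $M$ be a von Neumann algebra with a normal tracial state $\varphi$. **Notation.** Let $\mathrm{tr}_k$ be the normalized trace on $k\times k$ complex matrices. On the space $(M_k^{sa}(\mathbb C))^n$ of $n$-tuples of selfadjoint matrices let $|x-y|_2=\big(\sum_{i=1}^n \mathrm{tr}_k((x_i-y_i)^2)\big)^{1/2}$, and let $\mathrm{vol}$ be Lebesgue measure for the Euclidean norm $\big(k\sum_{i=1}^n\mathrm{tr}_k(x_i^2)\big)^{1/2}$. For $m\in\mathbb N$ and $R,\gamma>0$ and selfadjoint $z_1,\dots,z_n\in M$, let $\Gamma_R(z_1,\dots,z_n;m,k,\gamma)$ be the set of $x\in (M_k^{sa}(\mathbb C))^n$ with $\|x_i\|\le R$ (operator norm) for all $i$ and $|\mathrm{tr}_k(x_{i_1}\cdots x_{i_p})-\varphi(z_{i_1}\cdots z_{i_p})|<\gamma$ for all $1\le p\le m$ and $1\le i_1,\dots,i_p\le n$. The free entropy is $$\chi(z_1,\dots,z_n)=\sup_{R>0}\ \inf_{m\in\mathbb N,\gamma>0}\ \limsup_{k\to\infty}\Big(k^{-2}\log \mathrm{vol}\,\Gamma_R(z_1,\dots,z_n;m,k,\gamma)+\tfrac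 n2\log k\Big).$$ For a set $X$ in a metric space and $\epsilon>0$, $r\ge0$, let $H^r_\epsilon(X)$ be the infimum of $\sum_j|\theta_j|^r$ over countable covers $(\theta_j)$ of $X$ by sets of diameter $|\theta_j|\le\epsilon$. With $H^r_\epsilon$ taken for the metric $|\cdot|_2$, the free Hausdorff $r$-entropy is $$\mathbb H^r(z_1,\dots,z_n)=\sup_{R>0}\ \lim_{\epsilon\to0}\ \inf_{m\in\mathbb N,\gamma>0}\ \limsup_{k\to\infty}\ k^{-2}\log H^{rk^2}_\epsilon\big(\Gamma_R(z_1,\dots,z_n;m,k,\gamma)\big)\in[-\infty,\infty].$$ The set $\{z_1,\dots,z_n\}$ is called an *$s$-set* ($s\ge0$) if $-\infty<\mathbb H^s(z_1,\dots,z_n)<\infty$. It has *finite dimensional approximants* if there is $R>0$ such that for all $m\in\mathbb N$, $\gamma>0$ there is $k\ge1$ with $\Gamma_R(z_1,\dots,z_n;m,k,\gamma)\neq\emptyset$. The free Hausdorff dimension $\mathbb H(z_1,\dots,z_n)$ is $\inf\{r>0:\mathbb H^r(z_1,\dots,z_n)=-\infty\}$ if $\{z_1,\dots,z_n\}$ has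 finite dimensional approximants, and $-\infty$ otherwise. A *free semicircular family* is a family of selfadjoint elements $s_1,\dots,s_n\in M$, free with respect to $\varphi$, such that each $s_i$ has the standard semicircular distribution $\frac1{2\pi}\sqrt{4-t^2}\,dt$ on $[-2,2]$. **Corollary 3.8.** Let $z_1,\dots,z_n\in M$ be selfadjoint. If $\chi(z_1,\dots,z_n)>-\infty$, then $\{z_1,\dots,z_n\}$ is an $n$-set. In particular $\mathbb H(z_1,\dots,z_n)=n$. For example, if $s_1,\dots,s_n\in M$ is a free semicircular family, then $\chi(s_1,\dots,s_n)>-\infty$, so that $\{s_1,\dots,s_n\}$ is an $n$-set and $\mathbb H(s_1,\dots,s_n)=n$. -/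

import Mathlib

open MeasureTheory Filter Topology

/-! ### Tracial von Neumann algebras -/

section States

variable {H : Type*} [NormedAddCommGroup H] [InnerProductSpace ℂ H] [CompleteSpace H]

/-- `φ` is a normal tracial state on the von Neumann algebra `M ⊆ B(H)`. Normality: `φ` preserves
least upper bounds of upward directed families of positive elements (for the Loewner order). -/
structure IsNormalTracialState (M : VonNeumannAlgebra H)
    (φ : M.toStarSubalgebra →ₗ[ℂ] ℂ) : Prop where
  map_one : φ 1 = 1
  re_nonneg : ∀ a, 0 ≤ (φ (star a * a)).re
  im_eq_zero : ∀ a, (φ (star a * a)).im = 0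
  tracial : ∀ a b, φ (a * b) = φ (b * a)
  normal : ∀ (D : Set M.toStarSubalgebra) (a : M.toStarSubalgebra), D.Nonempty →
    (∀ x ∈ D, 0 ≤ (x : H →L[ℂ] H)) → DirectedOn (fun x y : M.toStarSubalgebra => (x : H →L[ℂ] H) ≤ y) D →
    (∀ x ∈ D, (x : H →L[ℂ] H) ≤ a) →
    (∀ b : M.toStarSubalgebra, (∀ x ∈ D, (x : H →L[ℂ] H) ≤ b) → (a : H →L[ℂ] H) ≤ b) →
    IsLUB ((fun x => (φ x).re) '' D) (φ a).re

end States

/-! ### Tuples of selfadjoint matrices -/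

/-- The real vector space of `n`-tuples of selfadjoint complex `k × k` matrices. -/
def HermTuple (n k : ℕ) : Type := Fin n → selfAdjoint (Matrix (Fin k) (Fin k) ℂ)

namespace HermTuple

variable {n k : ℕ}

noncomputable instance : AddCommGroup (HermTuple n k) :=
  inferInstanceAs (AddCommGroup (Fin n → selfAdjoint (Matrix (Fin k) (Fin k) ℂ)))

noncomputable instance : Module ℝ (HermTuple n k) :=
  inferInstanceAs (Module ℝ (Fin n → selfAdjoint (Matrix (Fin k) (Fin k) ℂ)))

/-- The `i`-th matrix of a tuple. -/
def mat (x : HermTuple n k) (i : Fin n) : Matrix (Fin k) (Fin k) ℂ :=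
  ((show Fin n → selfAdjoint (Matrix (Fin k) (Fin k) ℂ) from x) i :)

theorem mat_add (x y : HermTuple n k) (i : Fin n) : (x + y).mat i = x.mat i + y.mat i := rfl

theorem mat_smul (r : ℝ) (x : HermTuple n k) (i : Fin n) : (r • x).mat i = r • x.mat i := rfl

theorem conjTranspose_mat (x : HermTuple n k) (i : Fin n) : (x.mat i).conjTranspose = x.mat i :=
  ((show Fin n → selfAdjoint (Matrix (Fin k) (Fin k) ℂ) from x) i).2

theorem ext_mat {x y : HermTuple n k} (h : ∀ i, x.mat i = y.mat i) : x = y :=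
  funext fun i => Subtype.ext (h i)

theorem re_trace_sq (x : HermTuple n k) (i : Fin n) :
    (x.mat i * x.mat i).trace.re = ∑ a, ∑ b, ‖x.mat i a b‖ ^ 2 := by
  conv_lhs => rw [← conjTranspose_mat x i]
  rw [conjTranspose_mat x i]
  simp only [Matrix.trace, Matrix.diag, Matrix.mul_apply, Complex.re_sum]
  refine Finset.sum_congr rfl fun a _ => Finset.sum_congr rfl fun b _ => ?_
  have h : x.mat i b a = star (x.mat i a b) := by
    conv_lhs => rw [← conjTranspose_mat x i]
    rfl
  rw [h, Complex.star_def, Complex.mul_conj, Complex.ofReal_re, Complex.normSq_eq_norm_sq]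

/-- The inner product `⟪x, y⟫ = ∑ i, Tr (x i * y i)`, whose norm is
`(∑ i, Tr (x i ^ 2)) ^ (1/2) = (k * ∑ i, tr_k (x i ^ 2)) ^ (1/2)`. -/
noncomputable abbrev innerCore : InnerProductSpace.Core ℝ (HermTuple n k) where
  inner x y := ∑ i, (x.mat i * y.mat i).trace.re
  conj_inner_symm x y := by
    simp only [conj_trivial]
    exact Finset.sum_congr rfl fun i _ => by rw [Matrix.trace_mul_comm]
  re_inner_nonneg x := by
    simp only [RCLike.re_to_real, re_trace_sq]
    positivity
  add_left x y z := by
    simp [mat_add, add_mul, Finset.sum_add_distrib]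
  smul_left x y r := by
    simp [mat_smul, Finset.mul_sum]
  definite x h := by
    simp only [re_trace_sq] at h
    refine ext_mat fun i => Matrix.ext fun a b => ?_
    have h1 := (Finset.sum_eq_zero_iff_of_nonneg (fun i _ => by positivity)).1 h i
      (Finset.mem_univ _)
    have h2 := (Finset.sum_eq_zero_iff_of_nonneg (fun i _ => by positivity)).1 h1 a
      (Finset.mem_univ _)
    have h3 := (Finset.sum_eq_zero_iff_of_nonneg (fun i _ => by positivity)).1 h2 b
      (Finset.mem_univ _)
    exact norm_eq_zero.1 (pow_eq_zero_iff two_ne_zero |>.1 h3)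

noncomputable instance : NormedAddCommGroup (HermTuple n k) :=
  innerCore.toNormedAddCommGroup

noncomputable instance : InnerProductSpace ℝ (HermTuple n k) :=
  InnerProductSpace.ofCore innerCore.toCore

instance : FiniteDimensional ℝ (HermTuple n k) :=
  haveI : FiniteDimensional ℝ (selfAdjoint (Matrix (Fin k) (Fin k) ℂ)) :=
    inferInstanceAs (FiniteDimensional ℝ
      (selfAdjoint.submodule ℝ (Matrix (Fin k) (Fin k) ℂ)))
  inferInstanceAs (FiniteDimensional ℝ (Fin n → selfAdjoint (Matrix (Fin k) (Fin k) ℂ)))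

noncomputable instance : MeasurableSpace (HermTuple n k) := borel _

instance : BorelSpace (HermTuple n k) := ⟨rfl⟩

end HermTuple

/-- The normalized trace on `k × k` matrices. -/
noncomputable def normTrace {k : ℕ} (A : Matrix (Fin k) (Fin k) ℂ) : ℂ := A.trace / (k : ℂ)

/-- The normalized Hilbert-Schmidt distance
`|x - y|₂ = (∑ i, tr_k ((x i - y i) ^ 2)) ^ (1/2)`. -/
noncomputable def hsDist {n k : ℕ} (x y : HermTuple n k) : ℝ :=
  √(∑ i, (normTrace ((x.mat i - y.mat i) * (x.mat i - y.mat i))).re)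

/-! ### Hausdorff quantities of a set, with respect to a given distance function -/

/-- The diameter of `S` with respect to the distance function `d`. -/
noncomputable def diamWrt {X : Type*} (d : X → X → ℝ) (S : Set X) : ENNReal :=
  ⨆ x ∈ S, ⨆ y ∈ S, ENNReal.ofReal (d x y)

/-- `H^r_ε(S)`: the infimum of `∑ |θ_j| ^ r` over all countable covers `(θ_j)` of `S` by sets of
diameter at most `ε`. Empty members (which also pad out finite covers) contribute nothing. -/
noncomputable def hausdorffContent {X : Type*} (d : X → X → ℝ) (ε r : ℝ) (S : Set X) : ENNReal :=
  ⨅ (θ : ℕ → Set X) (_ : S ⊆ ⋃ j, θ j) (_ : ∀ j, diamWrt d (θ j) ≤ ENNReal.ofReal ε),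
    ∑' j, ⨆ _ : (θ j).Nonempty, diamWrt d (θ j) ^ r

/-! ### Microstates, free entropy and free Hausdorff entropy

Here `A` is an arbitrary complex algebra with a linear functional `φ`; all quantities are computed
from the moments `φ (z i₁ * ⋯ * z iₚ)`. -/

section Microstates

variable {A : Type*} [Ring A] [Algebra ℂ A]

/-- The microstate space `Γ_R(z₁, …, zₙ; m, k, γ)`: tuples of selfadjoint `k × k` matrices of
operator norm at most `R` whose moments of order `p`, `1 ≤ p ≤ m`, are within `γ` of those of
`z₁, …, zₙ`. -/
def microstates (φ : A →ₗ[ℂ] ℂ) {n : ℕ} (z : Fin n → A) (R : ℝ) (m k : ℕ) (γ : ℝ) :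
    Set (HermTuple n k) :=
  {x | (∀ i, ‖Matrix.toEuclideanCLM (n := Fin k) (𝕜 := ℂ) (x.mat i)‖ ≤ R) ∧
    ∀ p : ℕ, 1 ≤ p → p ≤ m → ∀ w : Fin p → Fin n,
      ‖normTrace (List.ofFn fun j => x.mat (w j)).prod -
        φ (List.ofFn fun j => z (w j)).prod‖ < γ}

/-- `χ_R(z; m, γ) = limsup_k (k⁻² log vol Γ_R(z; m, k, γ) + (n/2) log k)`. -/
noncomputable def freeEntropyAt (φ : A →ₗ[ℂ] ℂ) {n : ℕ} (z : Fin n → A) (R : ℝ) (m : ℕ) (γ : ℝ) :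
    EReal :=
  limsup (fun k : ℕ => ((((k : ℝ) ^ 2)⁻¹ : ℝ) : EReal) *
      ENNReal.log (volume (microstates φ z R m k γ)) +
    (((n : ℝ) / 2 * Real.log k : ℝ) : EReal)) atTop

/-- Voiculescu's free entropy `χ(z) = sup_{R > 0} inf_{m, γ > 0} χ_R(z; m, γ)`. -/
noncomputable def freeEntropy (φ : A →ₗ[ℂ] ℂ) {n : ℕ} (z : Fin n → A) : EReal :=
  ⨆ (R : ℝ) (_ : 0 < R), ⨅ (m : ℕ) (γ : ℝ) (_ : 0 < γ), freeEntropyAt φ z R m γ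

/-- `ℍ^r_{ε,R}(z; m, γ) = limsup_k k⁻² log H^{rk²}_ε(Γ_R(z; m, k, γ))`. -/
noncomputable def freeHausdorffAt (φ : A →ₗ[ℂ] ℂ) {n : ℕ} (z : Fin n → A) (r ε R : ℝ) (m : ℕ)
    (γ : ℝ) : EReal :=
  limsup (fun k : ℕ => ((((k : ℝ) ^ 2)⁻¹ : ℝ) : EReal) *
    ENNReal.log (hausdorffContent hsDist ε (r * (k : ℝ) ^ 2) (microstates φ z R m k γ))) atTop

/-- `ℍ^r_{ε,R}(z) = inf_{m, γ > 0} ℍ^r_{ε,R}(z; m, γ)`. -/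
noncomputable def freeHausdorffScale (φ : A →ₗ[ℂ] ℂ) {n : ℕ} (z : Fin n → A) (r ε R : ℝ) : EReal :=
  ⨅ (m : ℕ) (γ : ℝ) (_ : 0 < γ), freeHausdorffAt φ z r ε R m γ

/-- `ℍ^r_R(z) = lim_{ε → 0} ℍ^r_{ε,R}(z)`, written as the supremum over `ε > 0`; it is the limit by
`tendsto_freeHausdorffScale`. -/
noncomputable def freeHausdorffCutoff (φ : A →ₗ[ℂ] ℂ) {n : ℕ} (z : Fin n → A) (r R : ℝ) : EReal :=
  ⨆ (ε : ℝ) (_ : 0 < ε), freeHausdorffScale φ z r ε R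

/-- The free Hausdorff `r`-entropy `ℍ^r(z) = sup_{R > 0} ℍ^r_R(z)`. -/
noncomputable def freeHausdorffEntropy (φ : A →ₗ[ℂ] ℂ) {n : ℕ} (z : Fin n → A) (r : ℝ) : EReal :=
  ⨆ (R : ℝ) (_ : 0 < R), freeHausdorffCutoff φ z r R

theorem hausdorffContent_anti {X : Type*} (d : X → X → ℝ) (r : ℝ) (S : Set X) {ε₁ ε₂ : ℝ}
    (h : ε₁ ≤ ε₂) : hausdorffContent d ε₂ r S ≤ hausdorffContent d ε₁ r S :=
  iInf_mono fun _ => iInf_mono fun _ => iInf_mono' fun h' =>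
    ⟨fun j => (h' j).trans (ENNReal.ofReal_le_ofReal h), le_rfl⟩

theorem freeHausdorffScale_anti (φ : A →ₗ[ℂ] ℂ) {n : ℕ} (z : Fin n → A) (r R : ℝ) :
    Antitone fun ε => freeHausdorffScale φ z r ε R := by
  intro ε₁ ε₂ h
  refine iInf_mono fun m => iInf_mono fun γ => iInf_mono fun _ => ?_
  refine limsup_le_limsup (Eventually.of_forall fun k => ?_)
  refine mul_le_mul_of_nonneg_left
    (ENNReal.log_monotone (hausdorffContent_anti _ _ _ h)) ?_
  exact_mod_cast (by positivity : (0 : ℝ) ≤ ((k : ℝ) ^ 2)⁻¹)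

theorem tendsto_freeHausdorffScale (φ : A →ₗ[ℂ] ℂ) {n : ℕ} (z : Fin n → A) (r R : ℝ) :
    Tendsto (fun ε => freeHausdorffScale φ z r ε R) (𝓝[>] 0)
      (𝓝 (freeHausdorffCutoff φ z r R)) := by
  have h := (freeHausdorffScale_anti φ z r R).tendsto_nhdsGT 0
  rw [sSup_image] at h
  exact h

/-- `z₁, …, zₙ` has finite dimensional approximants: for some cutoff `R`, all moments can be
approximated arbitrarily well by those of matrices of norm at most `R`. -/
def HasFiniteDimApproximants (φ : A →ₗ[ℂ] ℂ) {n : ℕ} (z : Fin n → A) : Prop :=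
  ∃ R : ℝ, 0 < R ∧ ∀ (m : ℕ) (γ : ℝ), 0 < γ → ∃ k : ℕ, 1 ≤ k ∧ (microstates φ z R m k γ).Nonempty

open Classical in
/-- The free Hausdorff dimension: `inf {r > 0 : ℍ^r(z) = -∞}` if `z` has finite dimensional
approximants, and `-∞` otherwise. -/
noncomputable def freeHausdorffDim (φ : A →ₗ[ℂ] ℂ) {n : ℕ} (z : Fin n → A) : EReal :=
  if HasFiniteDimApproximants φ z then
    ⨅ (r : ℝ) (_ : 0 < r) (_ : freeHausdorffEntropy φ z r = ⊥), (r : EReal)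
  else ⊥

/-- `{z₁, …, zₙ}` is an `s`-set: `-∞ < ℍ^s(z) < ∞`. -/
def IsFreeHausdorffSet (φ : A →ₗ[ℂ] ℂ) {n : ℕ} (z : Fin n → A) (s : ℝ) : Prop :=
  ⊥ < freeHausdorffEntropy φ z s ∧ freeHausdorffEntropy φ z s < ⊤

/-! ### Free semicircular families -/

/-- A family of unital subalgebras is free with respect to `φ`: alternating products of centered
elements are centered. -/
def AreFree (φ : A →ₗ[ℂ] ℂ) {ι : Type*} (B : ι → Subalgebra ℂ A) : Prop :=
  ∀ (p : ℕ) (w : Fin p → ι) (a : Fin p → A), 1 ≤ p → (∀ j, a j ∈ B (w j)) → (∀ j, φ (a j) = 0) →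
    (∀ j j' : Fin p, (j : ℕ) + 1 = j' → w j ≠ w j') → φ (List.ofFn a).prod = 0

/-- `s₁, …, sₙ` is a free semicircular family: the `sᵢ` are selfadjoint, have the standard
semicircular distribution `(2π)⁻¹ √(4 - t²) dt` on `[-2, 2]`, and are free. -/
structure IsFreeSemicircularFamily [StarRing A] (φ : A →ₗ[ℂ] ℂ) {n : ℕ} (s : Fin n → A) :
    Prop where
  selfAdjoint : ∀ i, IsSelfAdjoint (s i)
  moments : ∀ i (p : ℕ),
    φ (s i ^ p) = (((2 * Real.pi)⁻¹ * ∫ t in (-2 : ℝ)..2, t ^ p * √(4 - t ^ 2) : ℝ) : ℂ)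
  free : AreFree φ fun i => Algebra.adjoin ℂ {s i}

end Microstates

/-!
# Tuples of finite free entropy are `n`-sets

**Finite free entropy gives an `n`-set.** The space of `n`-tuples of selfadjoint `k × k` matrices is
Euclidean of dimension `n k ^ 2`, with norm `√k` times the metric `|·|₂`. A set of `|·|₂`-diameter
`δ` lies in a ball of Euclidean radius `√k δ`, whose volume is at most
`(2 π e / (n k)) ^ (n k ^ 2 / 2) * δ ^ (n k ^ 2)`. Summing over a cover, the volume of a microstate
space is at most `(2 π e / (n k)) ^ (n k ^ 2 / 2)` times its `n k ^ 2`-dimensional Hausdorff content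
(`volume_le_hausdorffContent`), and the factor is, on the scale `k⁻² log`, the normalization
`(n / 2) log k` of the free entropy up to a constant; so `ℍ^n > -∞`. Conversely, the moments of
order two bound the `|·|₂`-norm of all microstates by a constant `ρ` that depends neither on `k` nor
on the cutoff `R`, and a net of the ball of radius `ρ` shows that the content of dimension
`r k ^ 2`, `r ≥ n`, at scale `ε` is at most `((1 + 4 ρ) ^ n * ε ^ (r - n)) ^ (k ^ 2)`
(`hausdorffContent_le_exp`). Hence `ℍ^n < ∞`, and `ℍ^r = -∞` for `r > n`.

**Free semicircular families have finite free entropy.** Let `x` be a tuple of independent matrices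
of the Gaussian unitary ensemble. If `x` lies in a microstate space with probability at least
`1 / 2`, the maximum of the Gaussian density bounds the volume of that space from below
(`neg_log_two_le_of_gue`). The operator norms are at most `10` with high probability, by Gaussian
tails and a net of the unit ball (`HermTuple.tendsto_gue_opNorm`). For the moments, Gaussian
integration by parts gives
`E tr (xᵢ W) ∏ tr Wⱼ = ∑_{W = U xᵢ V} E tr U tr V ∏ tr Wⱼ + O(k⁻²)`, and an induction on the total
length of the words shows that `E ∏ tr Wⱼ` converges to `∏ τ Wⱼ`, where `τ` is the solution of
`τ (i W) = ∑_{W = U i V} τ U τ V` (`HermTuple.tendsto_integral_trProd`). As products of several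
traces are covered, the variances of the traces tend to `0`. Finally, a free semicircular family
solves the same equation (`IsFreeSemicircularFamily.schwingerDyson`): freeness and the orthogonality
of the Chebyshev polynomials mean that the state vanishes on the nonconstant Wick polynomials, and
multiplication by `sᵢ` acts on Wick polynomials as creation plus annihilation.
-/

/-! ### Sums over the occurrences of a letter in a word -/

/-- The sum of `f u v` over all decompositions `w = u ++ i :: v`, that is, over the occurrences
of the letter `i` in the word `w`. -/
def splitSum {ι V : Type*} [DecidableEq ι] [AddCommMonoid V] (i : ι) (w : List ι)
    (f : List ι → List ι → V) : V :=
  ∑ p ∈ Finset.range w.length, if w[p]? = some i then f (w.take p) (w.drop (p + 1)) else 0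

section SplitSum

variable {ι V : Type*} [DecidableEq ι] [AddCommMonoid V]

@[simp]
theorem splitSum_nil (i : ι) (f : List ι → List ι → V) : splitSum i [] f = 0 := rfl

theorem splitSum_cons (i j : ι) (w : List ι) (f : List ι → List ι → V) :
    splitSum i (j :: w) f =
      (if j = i then f [] w else 0) + splitSum i w fun u v => f (j :: u) v := by
  simp [splitSum, Finset.sum_range_succ', add_comm]

theorem splitSum_add (i : ι) (w : List ι) (f g : List ι → List ι → V) :
    splitSum i w (fun u v => f u v + g u v) = splitSum i w f + splitSum i w g := by
  simp only [splitSum, ← Finset.sum_add_distrib]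
  exact Finset.sum_congr rfl fun p _ => by split_ifs <;> simp

/-- Only decompositions into words of complementary lengths contribute. -/
theorem splitSum_congr {i : ι} {w : List ι} {f g : List ι → List ι → V}
    (h : ∀ u v, u.length + v.length + 1 = w.length → f u v = g u v) :
    splitSum i w f = splitSum i w g := by
  refine Finset.sum_congr rfl fun p hp => ?_
  have hp := Finset.mem_range.1 hp
  rw [h _ _ (by simp; omega)]

theorem splitSum_ite (i : ι) (w : List ι) (c : Prop) [Decidable c] (f : List ι → List ι → V) :
    splitSum i w (fun u v => if c then f u v else 0) = if c then splitSum i w f else 0 := by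
  by_cases h : c <;> simp [h, splitSum]

theorem map_splitSum {W F : Type*} [AddCommMonoid W] [FunLike F V W] [AddMonoidHomClass F V W]
    (g : F) (i : ι) (w : List ι) (f : List ι → List ι → V) :
    g (splitSum i w f) = splitSum i w fun u v => g (f u v) := by
  simp only [splitSum, map_sum]
  exact Finset.sum_congr rfl fun p _ => by split_ifs <;> simp

theorem mul_splitSum {R : Type*} [NonUnitalNonAssocSemiring R] (c : R) (i : ι) (w : List ι)
    (f : List ι → List ι → R) :
    c * splitSum i w f = splitSum i w fun u v => c * f u v :=
  map_splitSum (AddMonoidHom.mulLeft c) i w f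

theorem splitSum_mul {R : Type*} [NonUnitalNonAssocSemiring R] (c : R) (i : ι) (w : List ι)
    (f : List ι → List ι → R) :
    splitSum i w f * c = splitSum i w fun u v => f u v * c :=
  map_splitSum (AddMonoidHom.mulRight c) i w f

/-- Marking an occurrence of `i` and then an occurrence of `j` to its left is the same as marking
an occurrence of `j` and then an occurrence of `i` to its right. -/
theorem splitSum_assoc (i j : ι) (w : List ι) (f : List ι → List ι → List ι → V) :
    splitSum i w (fun u v => splitSum j u fun u₁ u₂ => f u₁ u₂ v) =
      splitSum j w fun u v => splitSum i v fun v₁ v₂ => f u v₁ v₂ := by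
  induction w generalizing f with
  | nil => simp
  | cons c w ih =>
    simp only [splitSum_cons, splitSum_nil, ite_self, zero_add, splitSum_add, splitSum_ite]
    rw [ih fun u₁ u₂ v => f (c :: u₁) u₂ v]

end SplitSum

/-! ### The Schwinger–Dyson equation for free semicircular families -/

section Wick

variable {A ι : Type*} [Ring A] [DecidableEq ι]

/-- The Wick polynomial of a word, with the factors in reverse order. For a free semicircular family
`s`, the Wick polynomials correspond to the basis vectors of the full Fock space: right
multiplication by `s j` is the sum of the creation and the annihilation operator of the letter `j`,
which is the recursion used as the definition. -/
def wick (s : ι → A) : List ι → A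
  | [] => 1
  | [j] => s j
  | j :: i :: u => wick s (i :: u) * s j - if i = j then wick s u else 0

theorem wick_mul (s : ι → A) (i j : ι) (u : List ι) :
    wick s (i :: u) * s j = wick s (j :: i :: u) + if i = j then wick s u else 0 := by
  rw [wick, sub_add_cancel]

/-- If `φ` is the vacuum state for the Wick polynomials, its moments satisfy a recursion: follow the
letter `i` to the factor of the word `w` annihilating it. -/
theorem wick_splitSum [Algebra ℂ A] (φ : A →ₗ[ℂ] ℂ) (s : ι → A) (h1 : φ 1 = 1)
    (hw : ∀ u, u ≠ [] → φ (wick s u) = 0) (i : ι) (u w : List ι) :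
    φ (wick s (i :: u) * (w.map s).prod) =
      splitSum i w fun a b => φ (a.map s).prod * φ (wick s u * (b.map s).prod) := by
  induction hn : w.length using Nat.strong_induction_on generalizing w i u with
  | _ N ih =>
    subst hn
    cases w with
    | nil => simp [hw]
    | cons j w =>
      have e1 : φ (wick s (i :: u) * ((j :: w).map s).prod) =
          φ (wick s (j :: i :: u) * (w.map s).prod) +
            if j = i then φ (wick s u * (w.map s).prod) else 0 := by
        rw [List.map_cons, List.prod_cons, ← mul_assoc, wick_mul, add_mul, map_add]
        by_cases h : j = i
        · simp [h]
        · simp [h, Ne.symm h]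
      -- In the first term of `e1`, the letter `j` has to be annihilated before `i` is.
      rw [e1, ih _ (by simp) j (i :: u) w rfl, splitSum_cons, add_comm]
      congr 1
      · simp [h1]
      · have e2 : ∀ a b : List ι, a.length + b.length + 1 = w.length →
            φ ((j :: a).map s).prod * φ (wick s u * (b.map s).prod) =
              splitSum j a fun a₁ a₂ => φ (a₁.map s).prod * φ (a₂.map s).prod *
                φ (wick s u * (b.map s).prod) := by
          intro a b hab
          have := ih a.length (by simp; omega) j [] a rfl
          simp only [wick, one_mul] at this
          rw [List.map_cons, List.prod_cons, this, splitSum_mul]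
        rw [splitSum_congr e2, splitSum_assoc]
        refine splitSum_congr fun a b hab => ?_
        rw [ih b.length (by simp; omega) i u b rfl, mul_splitSum]
        exact splitSum_congr fun _ _ _ => (mul_assoc _ _ _).symm

/-- The moments of a family whose Wick polynomials are centered satisfy the Schwinger–Dyson
equation. -/
theorem schwingerDyson_of_wick [Algebra ℂ A] (φ : A →ₗ[ℂ] ℂ) (s : ι → A) (h1 : φ 1 = 1)
    (hw : ∀ u, u ≠ [] → φ (wick s u) = 0) (i : ι) (w : List ι) :
    φ ((i :: w).map s).prod =
      splitSum i w fun a b => φ (a.map s).prod * φ (b.map s).prod := by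
  simpa [wick] using wick_splitSum φ s h1 hw i [] w

/-- Wick polynomials factor over the blocks of equal letters, with Chebyshev polynomials as
factors. -/
theorem wick_replicate_append [Algebra ℂ A] (s : ι → A) (i : ι) (u : List ι)
    (hu : u.head? ≠ some i) (l : ℕ) :
    wick s (List.replicate l i ++ u) =
      wick s u * Polynomial.aeval (s i) (Polynomial.Chebyshev.S ℂ l) := by
  induction l using Nat.twoStepInduction with
  | zero => simp
  | one =>
    cases u with
    | nil => simp [wick]
    | cons j u =>
      have : j ≠ i := by simpa using hu
      simp [wick, this]
  | more l h0 h1 =>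
    have e : wick s (List.replicate (l + 2) i ++ u) =
        wick s (List.replicate (l + 1) i ++ u) * s i - wick s (List.replicate l i ++ u) := by
      simp [List.replicate_succ, wick]
    rw [e, h0, h1]
    push_cast
    rw [Polynomial.Chebyshev.S_add_two, map_sub, mul_comm Polynomial.X, map_mul,
      Polynomial.aeval_X, mul_sub, mul_assoc]

theorem exists_eq_replicate_append (u : List ι) (hu : u ≠ []) :
    ∃ (i : ι) (l : ℕ) (v : List ι), u = List.replicate (l + 1) i ++ v ∧ v.head? ≠ some i := by
  induction u with
  | nil => exact absurd rfl hu
  | cons j w ih =>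
    by_cases hw : w = []
    · exact ⟨j, 0, [], by simp [hw], by simp⟩
    obtain ⟨i, l, v, h1, h2⟩ := ih hw
    by_cases hij : i = j
    · exact ⟨i, l + 1, v, by rw [h1, hij]; rfl, h2⟩
    · exact ⟨j, 0, w, rfl, by simp [h1, List.replicate_succ, hij]⟩

/-- A Wick polynomial is an alternating product of centered elements; the list `L` holds the factors
from right to left. -/
theorem exists_alternating_wick [Algebra ℂ A] (φ : A →ₗ[ℂ] ℂ) (s : ι → A)
    (hS : ∀ (i : ι) (l : ℕ), φ (Polynomial.aeval (s i) (Polynomial.Chebyshev.S ℂ (l + 1 : ℕ))) = 0)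
    (u : List ι) :
    ∃ L : List (ι × A), L.head?.map Prod.fst = u.head? ∧
      (∀ a ∈ L, a.2 ∈ Algebra.adjoin ℂ {s a.1} ∧ φ a.2 = 0) ∧
      L.IsChain (fun a b => b.1 ≠ a.1) ∧ ((L.map Prod.snd).reverse).prod = wick s u := by
  induction hn : u.length using Nat.strong_induction_on generalizing u with
  | _ N ih =>
    subst hn
    by_cases hu : u = []
    · exact ⟨[], by simp [hu], by simp, by simp, by simp [hu, wick]⟩
    obtain ⟨i, l, v, rfl, hv⟩ := exists_eq_replicate_append u hu
    obtain ⟨L, hL1, hL2, hL3, hL4⟩ := ih v.length (by simp) v rfl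
    refine ⟨(i, Polynomial.aeval (s i) (Polynomial.Chebyshev.S ℂ (l + 1 : ℕ))) :: L, ?_, ?_, ?_, ?_⟩
    · simp [List.replicate_succ]
    · intro a ha
      rcases List.mem_cons.1 ha with rfl | ha
      · exact ⟨Polynomial.aeval_mem_adjoin_singleton _ _, hS i l⟩
      · exact hL2 a ha
    · refine List.isChain_cons.2 ⟨fun b hb => ?_, hL3⟩
      rintro rfl
      rw [← hL1] at hv
      exact hv (by simp [Option.mem_def.1 hb])
    · rw [wick_replicate_append s i v hv, ← hL4]
      simp

/-- In a free family of elements with centered Chebyshev polynomials, Wick polynomials are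
centered. -/
theorem map_wick_eq_zero [Algebra ℂ A] (φ : A →ₗ[ℂ] ℂ) (s : ι → A)
    (hS : ∀ (i : ι) (l : ℕ), φ (Polynomial.aeval (s i) (Polynomial.Chebyshev.S ℂ (l + 1 : ℕ))) = 0)
    (hfree : AreFree φ fun i => Algebra.adjoin ℂ {s i}) (u : List ι) (hu : u ≠ []) :
    φ (wick s u) = 0 := by
  obtain ⟨L, h1, h2, h3, h4⟩ := exists_alternating_wick φ s hS u
  rw [← List.map_reverse] at h4
  have hch : L.reverse.IsChain (fun a b => a.1 ≠ b.1) := by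
    rw [List.isChain_reverse]; exact h3
  have hmem : ∀ a ∈ L.reverse, a.2 ∈ Algebra.adjoin ℂ {s a.1} ∧ φ a.2 = 0 := fun a ha =>
    h2 a (List.mem_reverse.1 ha)
  have hne : L.reverse ≠ [] := by
    intro h
    rw [List.reverse_eq_nil_iff.1 h] at h1
    cases u with
    | nil => exact hu rfl
    | cons a u => simp at h1
  generalize L.reverse = K at *
  have := hfree K.length (fun j => (K.get j).1) (fun j => (K.get j).2)
    (List.length_pos_iff.2 hne) (fun j => (hmem _ (List.get_mem K j)).1)
    (fun j => (hmem _ (List.get_mem K j)).2) ?_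
  · rw [← h4]
    convert this using 3
    refine List.ext_getElem (by simp) fun n h h' => by simp
  · rintro ⟨a, ha⟩ ⟨b, hb⟩ rfl
    exact List.isChain_iff_getElem.1 hch a hb

end Wick

section Semicircle

open Real intervalIntegral

theorem integral_sin_mul_sin_eq_zero (l : ℕ) :
    ∫ θ in (0 : ℝ)..π, sin (((l : ℝ) + 2) * θ) * sin θ = 0 := by
  have h : ∀ a : ℕ, ∫ θ in (0 : ℝ)..π, cos (((a : ℝ) + 1) * θ) = 0 := by
    intro a
    have ha : (a : ℝ) + 1 ≠ 0 := by positivity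
    rw [integral_comp_mul_left (fun x => cos x) ha]
    have := Real.sin_nat_mul_pi (a + 1)
    push_cast at this
    simp [this]
  have e : ∀ θ : ℝ, sin (((l : ℝ) + 2) * θ) * sin θ =
      (cos (((l : ℝ) + 1) * θ) - cos ((((l + 2 : ℕ) : ℝ) + 1) * θ)) / 2 := by
    intro θ
    have e1 : ((l : ℝ) + 1) * θ = ((l : ℝ) + 2) * θ - θ := by ring
    have e2 : (((l + 2 : ℕ) : ℝ) + 1) * θ = ((l : ℝ) + 2) * θ + θ := by push_cast; ring
    rw [e1, e2, cos_sub, cos_add]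
    ring
  simp only [e]
  rw [intervalIntegral.integral_div, intervalIntegral.integral_sub, h, h]
  · simp
  · exact Continuous.intervalIntegrable (by fun_prop) _ _
  · exact Continuous.intervalIntegrable (by fun_prop) _ _

/-- The Chebyshev polynomials `S_l`, `l ≥ 1`, are orthogonal to `S_0 = 1` for the semicircle
law. -/
theorem integral_chebyshevS_mul_sqrt (l : ℕ) :
    ∫ t in (-2 : ℝ)..2, (Polynomial.Chebyshev.S ℝ (l + 1 : ℕ)).eval t * √(4 - t ^ 2) = 0 := by
  -- Substitute `t = 2 cos θ`.
  have key := integral_comp_mul_deriv (a := 0) (b := π) (f := fun θ => 2 * cos θ)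
    (f' := fun θ => -(2 * sin θ))
    (g := fun t => (Polynomial.Chebyshev.S ℝ (l + 1 : ℕ)).eval t * √(4 - t ^ 2))
    (fun x _ => by simpa using (hasDerivAt_cos x).const_mul 2)
    (by fun_prop) (by fun_prop)
  have e : ∀ θ ∈ Set.uIcc (0 : ℝ) π,
      ((fun t => (Polynomial.Chebyshev.S ℝ (l + 1 : ℕ)).eval t * √(4 - t ^ 2)) ∘
        fun θ => 2 * cos θ) θ * -(2 * sin θ) =
      -4 * (sin (((l : ℝ) + 2) * θ) * sin θ) := by
    intro θ hθ
    rw [Set.uIcc_of_le pi_pos.le] at hθ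
    have hs : 0 ≤ sin θ := sin_nonneg_of_nonneg_of_le_pi hθ.1 hθ.2
    have hsq : √(4 - (2 * cos θ) ^ 2) = 2 * sin θ := by
      rw [show 4 - (2 * cos θ) ^ 2 = (2 * sin θ) ^ 2 by
        rw [mul_pow, mul_pow, sin_sq]; ring, sqrt_sq (by positivity)]
    have hc := Polynomial.Chebyshev.S_two_mul_real_cos θ ((l + 1 : ℕ) : ℤ)
    push_cast at hc
    rw [show ((l : ℝ) + 1 + 1) * θ = ((l : ℝ) + 2) * θ by ring] at hc
    simp only [Function.comp_apply, hsq]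
    push_cast
    rw [← hc]
    ring
  rw [integral_congr e, intervalIntegral.integral_const_mul, integral_sin_mul_sin_eq_zero] at key
  simp only [cos_zero, cos_pi, mul_one, mul_neg, mul_zero] at key
  rw [intervalIntegral.integral_symm, ← key, neg_zero]

end Semicircle

section Semicircular

variable {A : Type*} [Ring A] [Algebra ℂ A] [StarRing A] {φ : A →ₗ[ℂ] ℂ} {n : ℕ} {s : Fin n → A}

theorem IsFreeSemicircularFamily.map_aeval (hs : IsFreeSemicircularFamily φ s) (i : Fin n)
    (p : Polynomial ℝ) :
    φ (Polynomial.aeval (s i) (p.map (algebraMap ℝ ℂ))) =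
      (((2 * Real.pi)⁻¹ * ∫ t in (-2 : ℝ)..2, p.eval t * √(4 - t ^ 2) : ℝ) : ℂ) := by
  induction p using Polynomial.induction_on' with
  | add p q hp hq =>
    rw [Polynomial.map_add, map_add, map_add, hp, hq]
    have : ∀ t : ℝ, (p + q).eval t * √(4 - t ^ 2) =
        p.eval t * √(4 - t ^ 2) + q.eval t * √(4 - t ^ 2) := fun t => by
      rw [Polynomial.eval_add, add_mul]
    simp only [this]
    rw [intervalIntegral.integral_add (Continuous.intervalIntegrable (by fun_prop) _ _)
      (Continuous.intervalIntegrable (by fun_prop) _ _)]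
    push_cast
    ring
  | monomial m a =>
    rw [Polynomial.map_monomial, Polynomial.aeval_monomial, ← Algebra.smul_def, map_smul,
      hs.moments]
    simp only [Polynomial.eval_monomial, mul_assoc]
    rw [intervalIntegral.integral_const_mul]
    simp only [Complex.coe_algebraMap, smul_eq_mul]
    push_cast
    ring

/-- The moments of a free semicircular family satisfy the Schwinger–Dyson equation. -/
theorem IsFreeSemicircularFamily.schwingerDyson (hs : IsFreeSemicircularFamily φ s)
    (h1 : φ 1 = 1) (i : Fin n) (w : List (Fin n)) :
    φ ((i :: w).map s).prod =
      splitSum i w fun a b => φ (a.map s).prod * φ (b.map s).prod := by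
  refine schwingerDyson_of_wick φ s h1 (map_wick_eq_zero φ s (fun i l => ?_) hs.free) i w
  rw [← Polynomial.Chebyshev.map_S (algebraMap ℝ ℂ), hs.map_aeval,
    integral_chebyshevS_mul_sqrt]
  simp

end Semicircular

/-! ### Nets and volumes of balls in finite dimension -/

section Nets

variable {E : Type*} [NormedAddCommGroup E] [NormedSpace ℝ E] [FiniteDimensional ℝ E]

theorem card_le_of_separated_of_norm_le {ρ δ : ℝ} (hρ : 0 ≤ ρ) (hδ : 0 < δ) (F : Finset E)
    (hF : ∀ x ∈ F, ‖x‖ ≤ ρ) (hsep : ∀ x ∈ F, ∀ y ∈ F, x ≠ y → δ ≤ dist x y) :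
    (F.card : ℝ) ≤ (1 + 2 * ρ / δ) ^ Module.finrank ℝ E := by
  borelize E
  let μ : Measure E := Measure.addHaar
  have hr : 0 < ρ + δ / 2 := by positivity
  have hδ2 : 0 < δ / 2 := by positivity
  -- The balls of radius `δ / 2` about the points are disjoint; compare volumes.
  have hdisj : Set.Pairwise (F : Set E)
      (Function.onFun Disjoint fun c => Metric.ball c (δ / 2)) := by
    intro c hc d hd hcd
    exact Metric.ball_disjoint_ball (by linarith [hsep c hc d hd hcd])
  have hsub : (⋃ c ∈ F, Metric.ball c (δ / 2)) ⊆ Metric.ball (0 : E) (ρ + δ / 2) := by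
    refine Set.iUnion₂_subset fun x hx => Metric.ball_subset_ball' ?_
    rw [dist_zero_right]
    linarith [hF x hx]
  have hI : (F.card : ENNReal) * ENNReal.ofReal ((δ / 2) ^ Module.finrank ℝ E) *
      μ (Metric.ball 0 1) ≤
      ENNReal.ofReal ((ρ + δ / 2) ^ Module.finrank ℝ E) * μ (Metric.ball 0 1) :=
    calc
      _ = μ (⋃ c ∈ F, Metric.ball c (δ / 2)) := by
        rw [measure_biUnion_finset hdisj fun c _ => measurableSet_ball]
        simp only [μ.addHaar_ball_of_pos _ hδ2, Finset.sum_const, nsmul_eq_mul, mul_assoc]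
      _ ≤ μ (Metric.ball (0 : E) (ρ + δ / 2)) := measure_mono hsub
      _ = _ := by rw [μ.addHaar_ball_of_pos _ hr]
  have hJ := (ENNReal.mul_le_mul_iff_left (Metric.measure_ball_pos μ _ zero_lt_one).ne'
    measure_ball_lt_top.ne).1 hI
  have hK := ENNReal.toReal_le_of_le_ofReal (by positivity) hJ
  rw [ENNReal.toReal_mul, ENNReal.toReal_natCast, ENNReal.toReal_ofReal (by positivity),
    ← le_div_iff₀ (by positivity), ← div_pow] at hK
  refine hK.trans_eq ?_
  congr 1
  field_simp
  ring

/-- A subset of the ball of radius `ρ` has a `δ`-net of at most `(1 + 2 ρ / δ) ^ dim E` points. -/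
theorem exists_finset_net {ρ δ : ℝ} (hρ : 0 ≤ ρ) (hδ : 0 < δ) (S : Set E)
    (hS : ∀ x ∈ S, ‖x‖ ≤ ρ) :
    ∃ F : Finset E, (∀ x ∈ F, x ∈ S) ∧ (∀ x ∈ S, ∃ y ∈ F, dist x y ≤ δ) ∧
      (F.card : ℝ) ≤ (1 + 2 * ρ / δ) ^ Module.finrank ℝ E := by
  classical
  -- A separated subset of maximal cardinality is a net.
  let P : ℕ → Prop := fun N => ∃ F : Finset E, F.card = N ∧ (∀ x ∈ F, x ∈ S) ∧
    ∀ x ∈ F, ∀ y ∈ F, x ≠ y → δ ≤ dist x y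
  have hcard : ∀ N, P N → (N : ℝ) ≤ (1 + 2 * ρ / δ) ^ Module.finrank ℝ E := by
    rintro N ⟨F, rfl, hFS, hF⟩
    exact card_le_of_separated_of_norm_le hρ hδ F (fun x hx => hS x (hFS x hx)) hF
  have hP0 : P 0 := ⟨∅, by simp⟩
  have hle : ∀ N, P N → N ≤ ⌊(1 + 2 * ρ / δ) ^ Module.finrank ℝ E⌋₊ := fun N hN =>
    Nat.le_floor (hcard N hN)
  obtain ⟨F, hFc, hFS, hF⟩ := Nat.findGreatest_spec (Nat.zero_le _) hP0
  refine ⟨F, hFS, fun x hx => ?_, hcard _ ⟨F, rfl, hFS, hF⟩⟩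
  by_contra! hfar
  have hxF : x ∉ F := fun h => by simpa using hδ.trans (hfar x h)
  have hP : P (F.card + 1) := by
    refine ⟨insert x F, Finset.card_insert_of_notMem hxF, fun y hy => ?_, ?_⟩
    · rcases Finset.mem_insert.1 hy with rfl | hy
      exacts [hx, hFS y hy]
    · intro y hy z hz hyz
      rcases Finset.mem_insert.1 hy with hy | hy <;> rcases Finset.mem_insert.1 hz with hz | hz
      · exact absurd (hy.trans hz.symm) hyz
      · rw [hy]
        exact (hfar z hz).le
      · rw [hz, dist_comm]
        exact (hfar y hy).le
      · exact hF y hy z hz hyz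
  have := Nat.le_findGreatest (hle _ hP) hP
  rw [← hFc] at this
  omega

end Nets

/-! ### Gaussian measures on Euclidean spaces -/

section PolyGrowth

variable {E : Type*} [NormedAddCommGroup E]

/-- Continuous functions of at most polynomial growth. -/
def PolyGrowth (f : E → ℂ) : Prop :=
  Continuous f ∧ ∃ (C : ℝ) (N : ℕ), ∀ x, ‖f x‖ ≤ C * (1 + ‖x‖) ^ N

namespace PolyGrowth

theorem const (a : ℂ) : PolyGrowth fun _ : E => a := ⟨continuous_const, ‖a‖, 0, by simp⟩

theorem mul {f g : E → ℂ} (hf : PolyGrowth f) (hg : PolyGrowth g) :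
    PolyGrowth fun x => f x * g x := by
  obtain ⟨hf, C, N, hC⟩ := hf
  obtain ⟨hg, D, M, hD⟩ := hg
  refine ⟨hf.mul hg, C * D, N + M, fun x => ?_⟩
  rw [norm_mul, pow_add, mul_mul_mul_comm]
  exact mul_le_mul (hC x) (hD x) (norm_nonneg _) ((norm_nonneg _).trans (hC x))

theorem add {f g : E → ℂ} (hf : PolyGrowth f) (hg : PolyGrowth g) :
    PolyGrowth fun x => f x + g x := by
  obtain ⟨hf, C, N, hC⟩ := hf
  obtain ⟨hg, D, M, hD⟩ := hg
  have hC0 : 0 ≤ C := by simpa using (norm_nonneg _).trans (hC 0)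
  have hD0 : 0 ≤ D := by simpa using (norm_nonneg _).trans (hD 0)
  refine ⟨hf.add hg, C + D, max N M, fun x => (norm_add_le _ _).trans ?_⟩
  have h1 : 1 ≤ 1 + ‖x‖ := by simp
  rw [add_mul]
  gcongr
  · exact (hC x).trans (by gcongr; exact le_max_left _ _)
  · exact (hD x).trans (by gcongr; exact le_max_right _ _)

theorem sum {ι : Type*} (s : Finset ι) {f : ι → E → ℂ} (hf : ∀ i ∈ s, PolyGrowth (f i)) :
    PolyGrowth fun x => ∑ i ∈ s, f i x := by
  classical
  induction s using Finset.induction_on with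
  | empty => simpa using const 0
  | insert a s ha ih =>
    simp only [Finset.sum_insert ha]
    exact (hf a (Finset.mem_insert_self _ _)).add
      (ih fun i hi => hf i (Finset.mem_insert_of_mem hi))

theorem ite {f g : E → ℂ} (p : Prop) [Decidable p] (hf : PolyGrowth f) (hg : PolyGrowth g) :
    PolyGrowth fun x => if p then f x else g x := by
  by_cases h : p <;> simpa [h]

end PolyGrowth

end PolyGrowth

section GaussianDensity

open Real

variable {E : Type*} [NormedAddCommGroup E] [InnerProductSpace ℝ E] {c : ℝ}

/-- The density of the centered Gaussian measure of covariance `c⁻¹ • id`. -/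
noncomputable def gaussianDensity (c : ℝ) (x : E) : ℝ :=
  (2 * π / c) ^ (-(Module.finrank ℝ E / 2 : ℝ)) * rexp (-(c / 2) * ‖x‖ ^ 2)

theorem gaussianDensity_nonneg (hc : 0 < c) (x : E) : 0 ≤ gaussianDensity c x := by
  unfold gaussianDensity
  positivity

theorem continuous_gaussianDensity : Continuous (gaussianDensity c : E → ℝ) := by
  unfold gaussianDensity
  fun_prop

theorem hasLineDerivAt_gaussianDensity (x v : E) :
    HasLineDerivAt ℝ (gaussianDensity c) (-(c * inner ℝ x v) * gaussianDensity c x) x v := by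
  have h1 : HasDerivAt (fun t : ℝ => ‖x + t • v‖ ^ 2) (2 * inner ℝ x v) 0 := by
    have h2 : HasDerivAt (fun t : ℝ => x + t • v) v 0 := by
      simpa using ((hasDerivAt_id (0 : ℝ)).smul_const v).const_add x
    simpa using h2.norm_sq
  have h3 := ((h1.const_mul (-(c / 2))).exp).const_mul
    ((2 * π / c) ^ (-(Module.finrank ℝ E / 2 : ℝ)))
  unfold HasLineDerivAt gaussianDensity
  refine h3.congr_deriv ?_
  simp only [zero_smul, add_zero]
  ring

end GaussianDensity

section Gaussian

open Real

variable {E : Type*} [NormedAddCommGroup E] [InnerProductSpace ℝ E] [FiniteDimensional ℝ E]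
  [MeasurableSpace E] [BorelSpace E]

theorem integrable_exp_neg_mul_sq_norm {b : ℝ} (hb : 0 < b) :
    Integrable fun x : E => rexp (-b * ‖x‖ ^ 2) := by
  have h := (GaussianFourier.integrable_cexp_neg_mul_sq_norm_add (V := E) (b := b)
    (by simpa using hb) 0 0).re
  refine h.congr (Eventually.of_forall fun x => ?_)
  simp only [zero_mul, add_zero]
  rw [show (-(b : ℂ) * (‖x‖ : ℂ) ^ 2) = ((-b * ‖x‖ ^ 2 : ℝ) : ℂ) by push_cast; ring]
  exact Complex.exp_ofReal_re _

/-- The volume of a ball, up to the subexponential factor in Stirling's formula. -/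
theorem volume_closedBall_le (x : E) {ρ : ℝ} (hρ : 0 ≤ ρ) :
    volume (Metric.closedBall x ρ) ≤
      ENNReal.ofReal (√(2 * π * rexp 1 / Module.finrank ℝ E) * ρ) ^ Module.finrank ℝ E := by
  -- Markov's inequality for the Gaussian integral.
  have key : ∀ (ρ b : ℝ), 0 < b → 0 ≤ ρ → volume (Metric.closedBall (0 : E) ρ) ≤
      ENNReal.ofReal (rexp (b * ρ ^ 2) * (π / b) ^ (Module.finrank ℝ E / 2 : ℝ)) := by
    intro ρ b hb hρ
    have h1 : ENNReal.ofReal (rexp (-b * ρ ^ 2)) * volume (Metric.closedBall (0 : E) ρ) ≤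
        ENNReal.ofReal ((π / b) ^ (Module.finrank ℝ E / 2 : ℝ)) := by
      rw [← GaussianFourier.integral_rexp_neg_mul_sq_norm (V := E) hb,
        ofReal_integral_eq_lintegral_ofReal (integrable_exp_neg_mul_sq_norm hb)
          (Eventually.of_forall fun x => (exp_pos _).le)]
      refine le_trans (mul_le_mul_right (measure_mono fun y hy => ?_) _)
        (mul_meas_ge_le_lintegral (by fun_prop) _)
      rw [mem_closedBall_zero_iff] at hy
      refine ENNReal.ofReal_le_ofReal (exp_le_exp.2 ?_)
      nlinarith [norm_nonneg y, pow_le_pow_left₀ (norm_nonneg y) hy 2]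
    calc volume (Metric.closedBall (0 : E) ρ)
        = ENNReal.ofReal (rexp (b * ρ ^ 2)) *
          (ENNReal.ofReal (rexp (-b * ρ ^ 2)) * volume (Metric.closedBall (0 : E) ρ)) := by
          rw [← mul_assoc, ← ENNReal.ofReal_mul (exp_pos _).le, ← exp_add]
          simp
      _ ≤ _ := by
          rw [ENNReal.ofReal_mul (exp_pos _).le]
          gcongr
  rcases Nat.eq_zero_or_pos (Module.finrank ℝ E) with h0 | h0
  · have := Module.finrank_zero_iff.1 h0
    have h := key 0 1 one_pos le_rfl
    rw [h0] at h ⊢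
    have e : Metric.closedBall x ρ = Metric.closedBall (0 : E) 0 := by
      ext y
      simp [Subsingleton.elim y x, Subsingleton.elim x 0, hρ]
    rw [e]
    simpa using h
  rw [Measure.addHaar_closedBall_center]
  have hd : (0 : ℝ) < Module.finrank ℝ E := by exact_mod_cast h0
  rcases hρ.eq_or_lt with rfl | hρ
  · have : Nontrivial E := Module.finrank_pos_iff.1 h0
    simp
  -- This value of `b` minimizes the bound.
  refine (key ρ (Module.finrank ℝ E / (2 * ρ ^ 2)) (by positivity) hρ.le).trans_eq ?_
  rw [← ENNReal.ofReal_pow (by positivity)]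
  congr 1
  have e1 : √(2 * π * rexp 1 / Module.finrank ℝ E) * ρ =
      √(rexp 1 * (π / (Module.finrank ℝ E / (2 * ρ ^ 2)))) := by
    rw [← sqrt_sq hρ.le, ← sqrt_mul (by positivity), sqrt_sq hρ.le]
    congr 1
    field_simp
  rw [e1, sqrt_eq_rpow, ← rpow_mul_natCast (by positivity),
    mul_rpow (by positivity) (by positivity), ← exp_mul]
  congr 2
  · field_simp
  · ring

/-- The centered Gaussian measure of covariance `c⁻¹ • id` on a Euclidean space. -/
noncomputable def gaussianMeasure (E : Type*) [NormedAddCommGroup E] [InnerProductSpace ℝ E]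
    [FiniteDimensional ℝ E] [MeasurableSpace E] [BorelSpace E] (c : ℝ) : Measure E :=
  volume.withDensity fun x => ENNReal.ofReal (gaussianDensity c x)

variable {c : ℝ}

theorem integrable_gaussianDensity (hc : 0 < c) : Integrable (gaussianDensity c : E → ℝ) :=
  (integrable_exp_neg_mul_sq_norm (by positivity)).const_mul _

theorem lintegral_gaussianDensity (hc : 0 < c) :
    ∫⁻ x : E, ENNReal.ofReal (gaussianDensity c x) = 1 := by
  rw [← ofReal_integral_eq_lintegral_ofReal (integrable_gaussianDensity hc)
    (Eventually.of_forall (gaussianDensity_nonneg hc))]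
  unfold gaussianDensity
  rw [integral_const_mul, GaussianFourier.integral_rexp_neg_mul_sq_norm (by positivity),
    show π / (c / 2) = 2 * π / c by field_simp, ← rpow_add (by positivity)]
  simp

theorem isProbabilityMeasure_gaussianMeasure (hc : 0 < c) :
    IsProbabilityMeasure (gaussianMeasure E c) :=
  ⟨by rw [gaussianMeasure, withDensity_apply _ MeasurableSet.univ, Measure.restrict_univ,
    lintegral_gaussianDensity hc]⟩

theorem integral_gaussianMeasure (hc : 0 < c) (f : E → ℂ) :
    ∫ x, f x ∂gaussianMeasure E c = ∫ x, gaussianDensity c x • f x := by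
  rw [gaussianMeasure, integral_withDensity_eq_integral_toReal_smul
    continuous_gaussianDensity.measurable.ennreal_ofReal (by simp)]
  simp only [ENNReal.toReal_ofReal (gaussianDensity_nonneg hc _)]

theorem integrable_gaussianMeasure_iff (hc : 0 < c) (f : E → ℂ) :
    Integrable f (gaussianMeasure E c) ↔ Integrable fun x => gaussianDensity c x • f x := by
  rw [gaussianMeasure, integrable_withDensity_iff_integrable_smul'
    continuous_gaussianDensity.measurable.ennreal_ofReal (by simp)]
  simp only [ENNReal.toReal_ofReal (gaussianDensity_nonneg hc _)]

theorem gaussianMeasure_le (hc : 0 < c) (S : Set E) :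
    gaussianMeasure E c S ≤
      ENNReal.ofReal ((2 * π / c) ^ (-(Module.finrank ℝ E / 2 : ℝ))) * volume S := by
  have h : gaussianMeasure E c ≤
      ENNReal.ofReal ((2 * π / c) ^ (-(Module.finrank ℝ E / 2 : ℝ))) • (volume : Measure E) := by
    rw [← withDensity_const]
    refine withDensity_mono (Eventually.of_forall fun x => ENNReal.ofReal_le_ofReal ?_)
    refine mul_le_of_le_one_right (by positivity) (exp_le_one_iff.2 ?_)
    have : 0 ≤ c / 2 * ‖x‖ ^ 2 := by positivity
    linarith
  exact h S

/-- Gaussian tails: translating by `t h` costs the factor `exp (-c t ^ 2 / 2)`. -/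
theorem gaussianMeasure_halfSpace_le (hc : 0 < c) {h : E} (hh : ‖h‖ ≤ 1) {t : ℝ} (ht : 0 ≤ t) :
    gaussianMeasure E c {x | t ≤ inner ℝ h x} ≤ ENNReal.ofReal (rexp (-(c * t ^ 2 / 2))) := by
  have hS : MeasurableSet {x : E | t ≤ inner ℝ h x} :=
    (isClosed_le continuous_const (by fun_prop)).measurableSet
  rw [gaussianMeasure, withDensity_apply _ hS]
  calc ∫⁻ x in {x : E | t ≤ inner ℝ h x}, ENNReal.ofReal (gaussianDensity c x)
      ≤ ∫⁻ x in {x : E | t ≤ inner ℝ h x}, ENNReal.ofReal (rexp (-(c * t ^ 2 / 2))) *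
          ENNReal.ofReal (gaussianDensity c (x - t • h)) := by
        refine setLIntegral_mono' hS fun x hx => ?_
        rw [← ENNReal.ofReal_mul (exp_pos _).le]
        refine ENNReal.ofReal_le_ofReal ?_
        rw [gaussianDensity, gaussianDensity, mul_left_comm, ← exp_add]
        gcongr
        rw [norm_sub_sq_real, norm_smul, inner_smul_right, real_inner_comm, norm_of_nonneg ht]
        have h1 : t * t ≤ t * inner ℝ h x := mul_le_mul_of_nonneg_left hx ht
        have h2 : (t * ‖h‖) ^ 2 ≤ t ^ 2 := by
          rw [mul_pow]
          exact mul_le_of_le_one_right (by positivity) (pow_le_one₀ (norm_nonneg _) hh)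
        nlinarith [mul_le_mul_of_nonneg_left h1 hc.le, mul_le_mul_of_nonneg_left h2 hc.le]
    _ ≤ ∫⁻ x : E, ENNReal.ofReal (rexp (-(c * t ^ 2 / 2))) *
          ENNReal.ofReal (gaussianDensity c (x - t • h)) := setLIntegral_le_lintegral _ _
    _ = ENNReal.ofReal (rexp (-(c * t ^ 2 / 2))) := by
        have hm : Measurable fun x : E => ENNReal.ofReal (gaussianDensity c (x - t • h)) :=
          (continuous_gaussianDensity.comp (continuous_sub_right _)).measurable.ennreal_ofReal
        rw [lintegral_const_mul _ hm,
          lintegral_sub_right_eq_self (fun x : E => ENNReal.ofReal (gaussianDensity c x)),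
          lintegral_gaussianDensity hc, mul_one]

theorem PolyGrowth.integrable (hc : 0 < c) {f : E → ℂ} (hf : PolyGrowth f) :
    Integrable f (gaussianMeasure E c) := by
  obtain ⟨hf, C, N, hC⟩ := hf
  have hC0 : 0 ≤ C := by simpa using (norm_nonneg _).trans (hC 0)
  rw [integrable_gaussianMeasure_iff hc]
  refine Integrable.mono' (((integrable_exp_neg_mul_sq_norm (E := E) (b := c / 4)
    (by positivity)).const_mul ((2 * π / c) ^ (-(Module.finrank ℝ E / 2 : ℝ)) *
      (C * (N.factorial * rexp (1 + 1 / c))))))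
    (continuous_gaussianDensity.smul hf).aestronglyMeasurable (Eventually.of_forall fun x => ?_)
  rw [norm_smul, norm_of_nonneg (gaussianDensity_nonneg hc x), gaussianDensity, mul_assoc,
    mul_assoc]
  refine mul_le_mul_of_nonneg_left ?_ (by positivity)
  have h1 : (1 + ‖x‖) ^ N ≤ N.factorial * rexp (1 + ‖x‖) := by
    have := pow_div_factorial_le_exp (1 + ‖x‖) (by positivity) N
    rwa [div_le_iff₀ (by positivity), mul_comm] at this
  calc rexp (-(c / 2) * ‖x‖ ^ 2) * ‖f x‖
      ≤ rexp (-(c / 2) * ‖x‖ ^ 2) * (C * (N.factorial * rexp (1 + ‖x‖))) := by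
        gcongr
        exact (hC x).trans (by gcongr)
    _ = C * N.factorial * rexp (-(c / 2) * ‖x‖ ^ 2 + (1 + ‖x‖)) := by
        rw [exp_add (-(c / 2) * ‖x‖ ^ 2)]; ring
    _ ≤ C * N.factorial * rexp (1 + 1 / c + -(c / 4) * ‖x‖ ^ 2) := by
        refine mul_le_mul_of_nonneg_left (exp_le_exp.2 ?_) (by positivity)
        have h2 : 0 ≤ (c / 2 * ‖x‖ - 1) ^ 2 / c := by positivity
        have h3 : (c / 2 * ‖x‖ - 1) ^ 2 / c = c / 4 * ‖x‖ ^ 2 - ‖x‖ + 1 / c := by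
          field_simp
          ring
        linarith
    _ = C * (N.factorial * rexp (1 + 1 / c)) * rexp (-(c / 4) * ‖x‖ ^ 2) := by
        rw [exp_add (1 + 1 / c)]; ring

/-- Gaussian integration by parts. -/
theorem integral_inner_mul_gaussianMeasure (hc : 0 < c) {f f' : E → ℂ} (hf : PolyGrowth f)
    (hf' : PolyGrowth f') (v : E) (hd : ∀ x, HasLineDerivAt ℝ f (f' x) x v) :
    ∫ x, (inner ℝ x v : ℂ) * f x ∂gaussianMeasure E c =
      (c : ℂ)⁻¹ * ∫ x, f' x ∂gaussianMeasure E c := by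
  have hin : PolyGrowth fun x : E => ((inner ℝ x v : ℝ) : ℂ) := by
    refine ⟨by fun_prop, ‖v‖, 1, fun x => ?_⟩
    rw [Complex.norm_real, pow_one, mul_comm]
    refine (norm_inner_le_norm x v).trans ?_
    gcongr
    linarith
  have key := integral_bilinear_hasLineDerivAt_right_eq_neg_left_of_integrable
    (μ := (volume : Measure E)) (B := (ContinuousLinearMap.lsmul ℝ ℝ (E := ℂ)).flip) (v := v)
    (f := f) (f' := f') (g := gaussianDensity c)
    (g' := fun x => -(c * inner ℝ x v) * gaussianDensity c x)
    ?_ ?_ ?_ (fun x _ => hd x) (fun x _ => hasLineDerivAt_gaussianDensity x v)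
  · simp only [ContinuousLinearMap.flip_apply, ContinuousLinearMap.lsmul_apply] at key
    rw [integral_gaussianMeasure hc, integral_gaussianMeasure hc]
    have e : ∀ x : E, (-(c * inner ℝ x v) * gaussianDensity c x) • f x =
        (-(c : ℂ)) * (gaussianDensity c x • (((inner ℝ x v : ℝ) : ℂ) * f x)) := by
      intro x
      simp only [Complex.real_smul]
      push_cast
      ring
    simp only [e] at key
    rw [integral_const_mul] at key
    have hc' : (c : ℂ) ≠ 0 := by exact_mod_cast hc.ne'
    rw [eq_inv_mul_iff_mul_eq₀ hc']
    linear_combination -key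
  · simpa using (integrable_gaussianMeasure_iff hc _).1 (hf'.integrable hc)
  · refine ((integrable_gaussianMeasure_iff hc _).1
      (((PolyGrowth.const (-(c : ℂ))).mul (hin.mul hf)).integrable hc)).congr
      (Eventually.of_forall fun x => ?_)
    simp only [ContinuousLinearMap.flip_apply, ContinuousLinearMap.lsmul_apply, Complex.real_smul]
    push_cast
    ring
  · simpa using (integrable_gaussianMeasure_iff hc _).1 (hf.integrable hc)

end Gaussian

/-! ### The Euclidean space of tuples of selfadjoint matrices -/

namespace HermTuple

variable {n k : ℕ}

theorem inner_eq (x y : HermTuple n k) :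
    inner ℝ x y = ∑ i, (x.mat i * y.mat i).trace.re := rfl

theorem norm_sq_eq (x : HermTuple n k) : ‖x‖ ^ 2 = ∑ i, ∑ a, ∑ b, ‖x.mat i a b‖ ^ 2 := by
  rw [← real_inner_self_eq_norm_sq, inner_eq]
  exact Finset.sum_congr rfl fun i _ => re_trace_sq x i

theorem mat_sub (x y : HermTuple n k) (i : Fin n) : (x - y).mat i = x.mat i - y.mat i := rfl

theorem norm_mat_apply_le (x : HermTuple n k) (i : Fin n) (a b : Fin k) :
    ‖x.mat i a b‖ ≤ ‖x‖ := by
  refine le_of_sq_le_sq ?_ (norm_nonneg _)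
  rw [norm_sq_eq]
  refine le_trans ?_ (Finset.single_le_sum (f := fun i => ∑ a, ∑ b, ‖x.mat i a b‖ ^ 2)
    (fun i _ => by positivity) (Finset.mem_univ i))
  refine le_trans ?_ (Finset.single_le_sum (f := fun a => ∑ b, ‖x.mat i a b‖ ^ 2)
    (fun i _ => by positivity) (Finset.mem_univ a))
  exact Finset.single_le_sum (f := fun b => ‖x.mat i a b‖ ^ 2)
    (fun i _ => by positivity) (Finset.mem_univ b)

theorem hsDist_eq (x y : HermTuple n k) : hsDist x y = ‖x - y‖ / √k := by
  have h : ∑ i, (normTrace ((x.mat i - y.mat i) * (x.mat i - y.mat i))).re =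
      ‖x - y‖ ^ 2 / k := by
    rw [← real_inner_self_eq_norm_sq, inner_eq, Finset.sum_div]
    refine Finset.sum_congr rfl fun i _ => ?_
    rw [normTrace, mat_sub, Complex.div_natCast_re]
  rw [hsDist, h, Real.sqrt_div (by positivity), Real.sqrt_sq (norm_nonneg _)]

theorem finrank_selfAdjoint_matrix (k : ℕ) :
    Module.finrank ℝ (selfAdjoint (Matrix (Fin k) (Fin k) ℂ)) = k ^ 2 := by
  have e1 := (StarModule.decomposeProdAdjoint ℝ (Matrix (Fin k) (Fin k) ℂ)).finrank_eq
  have : FiniteDimensional ℝ (selfAdjoint (Matrix (Fin k) (Fin k) ℂ)) :=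
    inferInstanceAs (FiniteDimensional ℝ
      (selfAdjoint.submodule ℝ (Matrix (Fin k) (Fin k) ℂ)))
  have : FiniteDimensional ℝ (skewAdjoint (Matrix (Fin k) (Fin k) ℂ)) :=
    inferInstanceAs (FiniteDimensional ℝ
      (skewAdjoint.submodule ℝ (Matrix (Fin k) (Fin k) ℂ)))
  -- Multiplication by `i` identifies the skew-adjoint with the selfadjoint matrices.
  have e2 : Module.finrank ℝ (skewAdjoint (Matrix (Fin k) (Fin k) ℂ)) =
      Module.finrank ℝ (selfAdjoint (Matrix (Fin k) (Fin k) ℂ)) := by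
    refine (LinearEquiv.ofBijective (skewAdjoint.negISMul (A := Matrix (Fin k) (Fin k) ℂ))
      ⟨?_, ?_⟩).finrank_eq
    · intro x y h
      have h' := congrArg (fun z : selfAdjoint (Matrix (Fin k) (Fin k) ℂ) =>
        Complex.I • (z : Matrix (Fin k) (Fin k) ℂ)) h
      simp only [skewAdjoint.I_smul_neg_I] at h'
      exact Subtype.ext h'
    · intro x
      refine ⟨⟨Complex.I • (x : Matrix (Fin k) (Fin k) ℂ), ?_⟩, Subtype.ext ?_⟩
      · rw [skewAdjoint.mem_iff, star_smul, selfAdjoint.mem_iff.1 x.2]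
        simp
      · simp [skewAdjoint.negISMul_apply_coe, smul_smul]
  rw [Module.finrank_prod, e2, Module.finrank_matrix, Fintype.card_fin,
    Complex.finrank_real_complex] at e1
  nlinarith

theorem finrank_eq (n k : ℕ) : Module.finrank ℝ (HermTuple n k) = n * k ^ 2 := by
  have : FiniteDimensional ℝ (selfAdjoint (Matrix (Fin k) (Fin k) ℂ)) :=
    inferInstanceAs (FiniteDimensional ℝ
      (selfAdjoint.submodule ℝ (Matrix (Fin k) (Fin k) ℂ)))
  have : Module.finrank ℝ (Fin n → selfAdjoint (Matrix (Fin k) (Fin k) ℂ)) = n * k ^ 2 := by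
    rw [Module.finrank_pi_fintype]
    simp [finrank_selfAdjoint_matrix]
  exact this

end HermTuple

/-! ### Comparison of Hausdorff content with volume -/

section Content

theorem le_diamWrt {X : Type*} (d : X → X → ℝ) {S : Set X} {x y : X} (hx : x ∈ S) (hy : y ∈ S) :
    ENNReal.ofReal (d x y) ≤ diamWrt d S :=
  le_iSup₂_of_le x hx (le_iSup₂_of_le y hy le_rfl)

/-- Finitely many sets of diameter at most `ε` bound the Hausdorff content of their union. -/
theorem hausdorffContent_le_card {X ι : Type*} (d : X → X → ℝ) {ε r : ℝ} (hr : 0 ≤ r) {S : Set X}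
    (F : Finset ι) (U : ι → Set X) (hS : ∀ x ∈ S, ∃ i ∈ F, x ∈ U i)
    (hU : ∀ i, ∀ x ∈ U i, ∀ y ∈ U i, d x y ≤ ε) :
    hausdorffContent d ε r S ≤ F.card * ENNReal.ofReal ε ^ r := by
  -- The sequence of sets is padded out by empty sets, which cost nothing.
  let θ : ℕ → Set X := fun j => {x | ∃ h : j < F.card, x ∈ U (F.equivFin.symm ⟨j, h⟩)}
  have hθ : ∀ j, diamWrt d (θ j) ≤ ENNReal.ofReal ε := fun j =>
    iSup₂_le fun x ⟨_, hx⟩ => iSup₂_le fun y ⟨_, hy⟩ => ENNReal.ofReal_le_ofReal (hU _ x hx y hy)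
  have hcov : S ⊆ ⋃ j, θ j := by
    intro x hx
    obtain ⟨i, hi, hxi⟩ := hS x hx
    refine Set.mem_iUnion.2 ⟨F.equivFin ⟨i, hi⟩, (F.equivFin ⟨i, hi⟩).2, ?_⟩
    simpa using hxi
  refine (iInf_le_of_le θ (iInf₂_le_of_le hcov hθ le_rfl)).trans ?_
  calc ∑' j, ⨆ _ : (θ j).Nonempty, diamWrt d (θ j) ^ r
      ≤ ∑' j, if j ∈ Finset.range F.card then ENNReal.ofReal ε ^ r else 0 := by
        refine ENNReal.tsum_le_tsum fun j => iSup_le fun hne => ?_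
        obtain ⟨x, h, -⟩ := hne
        rw [if_pos (Finset.mem_range.2 h)]
        exact ENNReal.rpow_le_rpow (hθ j) hr
    _ = F.card * ENNReal.ofReal ε ^ r := by
        rw [tsum_eq_sum (s := Finset.range F.card) (fun j hj => if_neg hj),
          Finset.sum_congr rfl (fun j hj => if_pos hj)]
        simp

theorem hausdorffContent_anti_exponent {X : Type*} (d : X → X → ℝ) {ε r s : ℝ} (hrs : r ≤ s)
    (hε : ε ≤ 1) (S : Set X) : hausdorffContent d ε s S ≤ hausdorffContent d ε r S := by
  refine iInf_mono fun θ => iInf_mono fun _ => iInf_mono fun hθ => ?_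
  refine ENNReal.tsum_le_tsum fun j => iSup_mono fun _ => ?_
  refine ENNReal.rpow_le_rpow_of_exponent_ge ((hθ j).trans ?_) hrs
  simpa using hε

variable {n k : ℕ}

/-- Isodiametric comparison: the content bounds the volume. -/
theorem volume_le_hausdorffContent (hk : 1 ≤ k) (ε : ℝ) (S : Set (HermTuple n k)) :
    volume S ≤ ENNReal.ofReal (√(2 * Real.pi * Real.exp 1 / (n * k ^ 2 : ℕ)) * √k) ^ (n * k ^ 2) *
      hausdorffContent hsDist ε (n * (k : ℝ) ^ 2) S := by
  have hk0 : (0 : ℝ) < k := by exact_mod_cast hk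
  set C := ENNReal.ofReal (√(2 * Real.pi * Real.exp 1 / (n * k ^ 2 : ℕ)) * √k) ^ (n * k ^ 2)
    with hC
  have hCtop : C ≠ ⊤ := ENNReal.pow_ne_top ENNReal.ofReal_ne_top
  have hC0 : C ≠ 0 := by
    rcases Nat.eq_zero_or_pos n with rfl | hn
    · simp [hC]
    · refine pow_ne_zero _ (ENNReal.ofReal_pos.2 ?_).ne'
      positivity
  rw [mul_comm, ← ENNReal.div_le_iff hC0 hCtop]
  refine le_iInf fun θ => le_iInf₂ fun hcov hθ => ?_
  rw [ENNReal.div_le_iff hC0 hCtop, ← ENNReal.tsum_mul_right]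
  refine (measure_mono hcov).trans ((measure_iUnion_le θ).trans (ENNReal.tsum_le_tsum fun j => ?_))
  rcases (θ j).eq_empty_or_nonempty with h | ⟨x, hx⟩
  · simp [h]
  have hne : (θ j).Nonempty := ⟨x, hx⟩
  have hD : diamWrt hsDist (θ j) ≠ ⊤ := ne_top_of_le_ne_top ENNReal.ofReal_ne_top (hθ j)
  rw [iSup_pos hne]
  have hsub : θ j ⊆ Metric.closedBall x (√k * (diamWrt hsDist (θ j)).toReal) := by
    intro y hy
    have h1 : hsDist y x ≤ (diamWrt hsDist (θ j)).toReal :=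
      (ENNReal.ofReal_le_iff_le_toReal hD).1 (le_diamWrt hsDist hy hx)
    rw [HermTuple.hsDist_eq, div_le_iff₀ (by positivity), mul_comm] at h1
    rwa [Metric.mem_closedBall, dist_eq_norm]
  refine (measure_mono hsub).trans ((volume_closedBall_le x (by positivity)).trans_eq ?_)
  rw [HermTuple.finrank_eq, ← mul_assoc, ENNReal.ofReal_mul (by positivity),
    ENNReal.ofReal_toReal hD, mul_pow, mul_comm, ← hC]
  congr 1
  rw [← ENNReal.rpow_natCast]
  push_cast
  rfl

/-- Bounded sets of tuples have small content, by a net of balls. -/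
theorem hausdorffContent_le_exp (hk : 1 ≤ k) {ρ ε r : ℝ} (hρ : 0 ≤ ρ) (hε : 0 < ε) (hε1 : ε ≤ 1)
    (hr : (n : ℝ) ≤ r) (S : Set (HermTuple n k)) (hS : ∀ x ∈ S, hsDist x 0 ≤ ρ) :
    hausdorffContent hsDist ε (r * (k : ℝ) ^ 2) S ≤ ENNReal.ofReal
      (Real.exp ((k : ℝ) ^ 2 * (n * Real.log (1 + 4 * ρ) + (r - n) * Real.log ε))) := by
  have hk0 : (0 : ℝ) < k := by exact_mod_cast hk
  have hr0 : 0 ≤ r := n.cast_nonneg.trans hr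
  have hsk : 0 < √(k : ℝ) := Real.sqrt_pos.2 hk0
  obtain ⟨F, -, hF, hcard⟩ := exists_finset_net (ρ := √k * ρ) (δ := √k * ε / 2) (by positivity)
    (by positivity) S (fun x hx => by
      have := hS x hx
      rwa [HermTuple.hsDist_eq, sub_zero, div_le_iff₀ (by positivity), mul_comm] at this)
  refine (hausdorffContent_le_card hsDist (by positivity) F
    (fun x => Metric.closedBall x (√k * ε / 2)) hF fun c x hx y hy => ?_).trans ?_
  · rw [HermTuple.hsDist_eq, div_le_iff₀ (by positivity), ← dist_eq_norm]
    have := dist_triangle_right x y c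
    rw [Metric.mem_closedBall] at hx hy
    linarith
  rw [← ENNReal.ofReal_natCast, ENNReal.ofReal_rpow_of_pos hε,
    ← ENNReal.ofReal_mul (by positivity)]
  refine ENNReal.ofReal_le_ofReal ?_
  rw [HermTuple.finrank_eq] at hcard
  have e1 : 1 + 2 * (√k * ρ) / (√k * ε / 2) = (ε + 4 * ρ) / ε := by
    field_simp
    ring
  rw [e1] at hcard
  calc (F.card : ℝ) * ε ^ (r * (k : ℝ) ^ 2)
      ≤ ((1 + 4 * ρ) / ε) ^ (n * k ^ 2) * ε ^ (r * (k : ℝ) ^ 2) := by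
        gcongr
        exact hcard.trans (by gcongr)
    _ = Real.exp ((k : ℝ) ^ 2 * (n * Real.log (1 + 4 * ρ) + (r - n) * Real.log ε)) := by
        rw [← Real.rpow_natCast, Real.rpow_def_of_pos (by positivity), Real.rpow_def_of_pos hε,
          ← Real.exp_add, Real.log_div (by positivity) hε.ne']
        congr 1
        push_cast
        ring

end Content

/-! ### Free Hausdorff entropy of tuples of finite free entropy -/

section FreeHausdorff

variable {A : Type*} [Ring A] [Algebra ℂ A] {φ : A →ₗ[ℂ] ℂ} {n : ℕ} {z : Fin n → A}

/-- Moments of order two control the Hilbert–Schmidt norm of microstates, independently of the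
operator norm cutoff. -/
theorem hsDist_le_of_mem_microstates {R γ : ℝ} {m k : ℕ} (hm : 2 ≤ m) (hγ : γ ≤ 1)
    {x : HermTuple n k} (hx : x ∈ microstates φ z R m k γ) :
    hsDist x 0 ≤ √(∑ i, (‖φ (z i * z i)‖ + 1)) := by
  refine Real.sqrt_le_sqrt (Finset.sum_le_sum fun i _ => ?_)
  have h := hx.2 2 (by norm_num) hm fun _ => i
  simp only [List.ofFn_succ, List.ofFn_zero, List.prod_cons, List.prod_nil, mul_one] at h
  have e : x.mat i - (0 : HermTuple n k).mat i = x.mat i := sub_zero _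
  rw [e]
  have h2 := norm_sub_norm_le (normTrace (x.mat i * x.mat i)) (φ (z i * z i))
  linarith [Complex.re_le_norm (normTrace (x.mat i * x.mat i))]

/-- The logarithmic growth rate of a quantity bounded by `exp (k ^ 2 * L)` is at most `L`. -/
theorem inv_sq_mul_log_le {k : ℕ} (hk : 1 ≤ k) {a : ENNReal} {L : ℝ}
    (h : a ≤ ENNReal.ofReal (Real.exp ((k : ℝ) ^ 2 * L))) :
    ((((k : ℝ) ^ 2)⁻¹ : ℝ) : EReal) * ENNReal.log a ≤ (L : EReal) := by
  have hk0 : (0 : ℝ) < k := by exact_mod_cast hk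
  refine (mul_le_mul_of_nonneg_left (ENNReal.log_monotone h)
    (by exact_mod_cast (by positivity : (0 : ℝ) ≤ ((k : ℝ) ^ 2)⁻¹))).trans_eq ?_
  rw [ENNReal.log_ofReal_of_pos (Real.exp_pos _), Real.log_exp, ← EReal.coe_mul,
    inv_mul_cancel_left₀ (by positivity)]

theorem freeHausdorffScale_le {r ε : ℝ} (hε : 0 < ε) (hε1 : ε ≤ 1) (hr : (n : ℝ) ≤ r) (R : ℝ) :
    freeHausdorffScale φ z r ε R ≤
      ((n * Real.log (1 + 4 * √(∑ i, (‖φ (z i * z i)‖ + 1))) + (r - n) * Real.log ε : ℝ) :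
        EReal) := by
  refine (iInf_le_of_le 2 (iInf₂_le_of_le 1 one_pos le_rfl)).trans ?_
  refine limsup_le_of_le (by isBoundedDefault) ?_
  filter_upwards [eventually_ge_atTop 1] with k hk
  exact inv_sq_mul_log_le hk (hausdorffContent_le_exp hk (Real.sqrt_nonneg _) hε hε1 hr _
    fun x hx => hsDist_le_of_mem_microstates le_rfl le_rfl hx)

theorem freeHausdorffEntropy_le {r ε : ℝ} (hε : 0 < ε) (hε1 : ε ≤ 1) (hr : (n : ℝ) ≤ r) :
    freeHausdorffEntropy φ z r ≤
      ((n * Real.log (1 + 4 * √(∑ i, (‖φ (z i * z i)‖ + 1))) + (r - n) * Real.log ε : ℝ) :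
        EReal) := by
  refine iSup₂_le fun R _ => iSup₂_le fun δ hδ => ?_
  rcases le_total ε δ with h | h
  · exact (freeHausdorffScale_anti φ z r R h).trans (freeHausdorffScale_le hε hε1 hr R)
  · refine (freeHausdorffScale_le hδ (h.trans hε1) hr R).trans (EReal.coe_le_coe_iff.2 ?_)
    have := Real.log_le_log hδ h
    have := mul_le_mul_of_nonneg_left this (sub_nonneg.2 hr)
    linarith

theorem freeHausdorffEntropy_lt_top : freeHausdorffEntropy φ z n < ⊤ :=
  (freeHausdorffEntropy_le one_pos le_rfl le_rfl).trans_lt (EReal.coe_lt_top _)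

theorem freeHausdorffEntropy_eq_bot {r : ℝ} (hr : (n : ℝ) < r) :
    freeHausdorffEntropy φ z r = ⊥ := by
  rw [EReal.eq_bot_iff_forall_lt]
  intro y
  set B := n * Real.log (1 + 4 * √(∑ i, (‖φ (z i * z i)‖ + 1))) with hB
  have hrn : 0 < r - n := sub_pos.2 hr
  -- The scale is chosen to make the bound `B - |B - y| - 1`.
  refine (freeHausdorffEntropy_le (ε := Real.exp (-((|B - y| + 1) / (r - n)))) (Real.exp_pos _)
    (Real.exp_le_one_iff.2 (by simpa using by positivity)) hr.le).trans_lt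
    (EReal.coe_lt_coe_iff.2 ?_)
  rw [Real.log_exp, ← hB, mul_neg, mul_div_cancel₀ _ hrn.ne']
  linarith [le_abs_self (B - y)]

theorem freeHausdorffEntropy_anti {r s : ℝ} (hrs : r ≤ s) :
    freeHausdorffEntropy φ z s ≤ freeHausdorffEntropy φ z r := by
  refine iSup₂_mono fun R _ => iSup₂_le fun ε hε => ?_
  refine (freeHausdorffScale_anti φ z s R (min_le_left ε 1)).trans
    (le_trans ?_ (le_iSup₂_of_le (min ε 1) (lt_min hε one_pos) le_rfl))
  refine iInf_mono fun m => iInf₂_mono fun γ _ => ?_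
  refine limsup_le_limsup (Eventually.of_forall fun k => ?_)
  refine mul_le_mul_of_nonneg_left (ENNReal.log_monotone
    (hausdorffContent_anti_exponent _ (by gcongr) (min_le_right _ _) _)) ?_
  exact_mod_cast (by positivity : (0 : ℝ) ≤ ((k : ℝ) ^ 2)⁻¹)

/-- At every scale `ε`, the free entropy is at most the free Hausdorff `n`-entropy plus a constant.
The junk values at `n = 0` make the constant `0`, as it should be. -/
theorem freeEntropyAt_le (R ε : ℝ) (m : ℕ) (γ : ℝ) :
    freeEntropyAt φ z R m γ ≤ freeHausdorffAt φ z n ε R m γ +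
      ((n / 2 * Real.log (2 * Real.pi * Real.exp 1 / n) : ℝ) : EReal) := by
  set c : ℝ := n / 2 * Real.log (2 * Real.pi * Real.exp 1 / n) with hc
  have hlim : limsup (fun _ : ℕ => (c : EReal)) atTop = c := limsup_const _
  refine le_trans (limsup_le_limsup ?_) ((EReal.limsup_add_le (u := fun k : ℕ =>
    ((((k : ℝ) ^ 2)⁻¹ : ℝ) : EReal) * ENNReal.log (hausdorffContent hsDist ε (n * (k : ℝ) ^ 2)
      (microstates φ z R m k γ))) (v := fun _ => (c : EReal))
    (.inr (by rw [hlim]; exact EReal.coe_ne_top c))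
    (.inr (by rw [hlim]; exact EReal.coe_ne_bot c))).trans_eq (by rw [hlim]; rfl))
  filter_upwards [eventually_ge_atTop 1] with k hk
  have hk0 : (0 : ℝ) < k := by exact_mod_cast hk
  have hk2 : (0 : EReal) ≤ ((((k : ℝ) ^ 2)⁻¹ : ℝ) : EReal) := by
    exact_mod_cast (by positivity : (0 : ℝ) ≤ ((k : ℝ) ^ 2)⁻¹)
  have h1 := mul_le_mul_of_nonneg_left
    (ENNReal.log_monotone (volume_le_hausdorffContent hk ε (microstates φ z R m k γ))) hk2
  rw [ENNReal.log_mul_add, EReal.left_distrib_of_nonneg_of_ne_top hk2 (EReal.coe_ne_top _)] at h1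
  have h2 : ((((k : ℝ) ^ 2)⁻¹ : ℝ) : EReal) *
      ENNReal.log (ENNReal.ofReal (√(2 * Real.pi * Real.exp 1 / (n * k ^ 2 : ℕ)) * √k) ^
        (n * k ^ 2)) = ((c - n / 2 * Real.log k : ℝ) : EReal) := by
    rcases Nat.eq_zero_or_pos n with rfl | hn
    · simp [hc]
    have hn0 : (0 : ℝ) < n := by exact_mod_cast hn
    rw [ENNReal.log_pow, ENNReal.log_ofReal_of_pos (by positivity), ← Real.sqrt_mul (by positivity),
      Real.log_sqrt (by positivity)]
    have e : 2 * Real.pi * Real.exp 1 / (n * k ^ 2 : ℕ) * k =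
        2 * Real.pi * Real.exp 1 / n / k := by
      push_cast
      field_simp
    rw [e, Real.log_div (by positivity) hk0.ne', hc,
      show ((n * k ^ 2 : ℕ) : EReal) = (((n * k ^ 2 : ℕ) : ℝ) : EReal) from rfl, ← EReal.coe_mul,
      ← EReal.coe_mul]
    congr 1
    push_cast
    field_simp
  rw [h2] at h1
  refine (add_le_add_left h1 _).trans_eq ?_
  rw [add_comm _ (((((k : ℝ) ^ 2)⁻¹ : ℝ) : EReal) * _), add_assoc, ← EReal.coe_add, sub_add_cancel]
  rfl

theorem exists_le_freeEntropyAt (h : ⊥ < freeEntropy φ z) :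
    ∃ R : ℝ, 0 < R ∧ ∃ L : ℝ, ∀ (m : ℕ) (γ : ℝ), 0 < γ → (L : EReal) ≤ freeEntropyAt φ z R m γ := by
  obtain ⟨R, hR⟩ := lt_iSup_iff.1 h
  obtain ⟨hR0, hR⟩ := lt_iSup_iff.1 hR
  obtain ⟨L, -, hL⟩ := EReal.lt_iff_exists_real_btwn.1 hR
  exact ⟨R, hR0, L, fun m γ hγ => hL.le.trans (iInf_le_of_le m (iInf₂_le γ hγ))⟩

theorem bot_lt_freeHausdorffEntropy (h : ⊥ < freeEntropy φ z) :
    ⊥ < freeHausdorffEntropy φ z n := by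
  obtain ⟨R, hR, L, hL⟩ := exists_le_freeEntropyAt h
  set c : ℝ := n / 2 * Real.log (2 * Real.pi * Real.exp 1 / n) with hc
  refine (EReal.bot_lt_coe (L - c)).trans_le ?_
  refine le_iSup₂_of_le R hR (le_iSup₂_of_le 1 one_pos ?_)
  refine le_iInf fun m => le_iInf₂ fun γ hγ => ?_
  have h1 := (hL m γ hγ).trans (freeEntropyAt_le R 1 m γ)
  rw [EReal.coe_sub]
  exact EReal.sub_le_of_le_add h1

theorem hasFiniteDimApproximants_of_freeEntropy (h : ⊥ < freeEntropy φ z) :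
    HasFiniteDimApproximants φ z := by
  obtain ⟨R, hR, L, hL⟩ := exists_le_freeEntropyAt h
  refine ⟨R, hR, fun m γ hγ => ?_⟩
  by_contra! hne
  refine absurd (hL m γ hγ) (not_le.2 ?_)
  refine lt_of_eq_of_lt ?_ (EReal.bot_lt_coe L)
  refine le_bot_iff.1 (limsup_le_of_le (by isBoundedDefault) ?_)
  filter_upwards [eventually_ge_atTop 1] with k hk
  have hk0 : (0 : ℝ) < k := by exact_mod_cast hk
  rw [hne k hk, measure_empty, ENNReal.log_zero, EReal.coe_mul_bot_of_pos (by positivity),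
    EReal.bot_add]

theorem isFreeHausdorffSet_of_freeEntropy (h : ⊥ < freeEntropy φ z) :
    IsFreeHausdorffSet φ z n :=
  ⟨bot_lt_freeHausdorffEntropy h, freeHausdorffEntropy_lt_top⟩

theorem freeHausdorffDim_of_freeEntropy (h : ⊥ < freeEntropy φ z) :
    freeHausdorffDim φ z = ((n : ℝ) : EReal) := by
  rw [freeHausdorffDim, if_pos (hasFiniteDimApproximants_of_freeEntropy h)]
  refine le_antisymm ?_ ?_
  · refine le_of_forall_gt fun y hy => ?_
    obtain ⟨r, hr, hry⟩ := EReal.lt_iff_exists_real_btwn.1 hy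
    have hr := EReal.coe_lt_coe_iff.1 hr
    refine lt_of_le_of_lt ?_ hry
    exact iInf_le_of_le r (iInf₂_le_of_le (n.cast_nonneg.trans_lt hr)
      (freeHausdorffEntropy_eq_bot hr) le_rfl)
  · refine le_iInf fun r => le_iInf₂ fun _ hbot => EReal.coe_le_coe_iff.2 ?_
    by_contra! hrn
    have := (bot_lt_freeHausdorffEntropy h).trans_le (freeHausdorffEntropy_anti hrn.le)
    exact this.ne' hbot

end FreeHausdorff

/-! ### Schwinger–Dyson equation for Gaussian random matrices -/

theorem PolyGrowth.splitSum {E ι : Type*} [NormedAddCommGroup E] [DecidableEq ι] (i : ι)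
    (w : List ι) {f : List ι → List ι → E → ℂ} (hf : ∀ u v, PolyGrowth (f u v)) :
    PolyGrowth fun x => splitSum i w fun u v => f u v x :=
  PolyGrowth.sum _ fun _ _ => (hf _ _).ite _ (.const 0)

namespace HermTuple

variable {n k : ℕ}

/-- The product of the matrices of a tuple along a word. -/
noncomputable def word (x : HermTuple n k) (w : List (Fin n)) : Matrix (Fin k) (Fin k) ℂ :=
  (w.map x.mat).prod

@[simp]
theorem word_nil (x : HermTuple n k) : x.word [] = 1 := rfl

theorem word_cons (x : HermTuple n k) (i : Fin n) (w : List (Fin n)) :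
    x.word (i :: w) = x.mat i * x.word w := by
  simp [word]

theorem word_append (x : HermTuple n k) (u v : List (Fin n)) :
    x.word (u ++ v) = x.word u * x.word v := by
  simp [word]

/-- The product of the normalized traces of a list of words. -/
noncomputable def trProd (L : List (List (Fin n))) (x : HermTuple n k) : ℂ :=
  (L.map fun w => normTrace (x.word w)).prod

@[simp]
theorem trProd_nil (x : HermTuple n k) : trProd [] x = 1 := rfl

theorem trProd_cons (w : List (Fin n)) (L : List (List (Fin n))) (x : HermTuple n k) :
    trProd (w :: L) x = normTrace (x.word w) * trProd L x := by
  simp [trProd]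

/-- The tuple with the selfadjoint matrix `a` at position `i` and `0` elsewhere. -/
noncomputable def single (i : Fin n) (a : selfAdjoint (Matrix (Fin k) (Fin k) ℂ)) :
    HermTuple n k :=
  (Pi.single i a : Fin n → selfAdjoint (Matrix (Fin k) (Fin k) ℂ))

theorem mat_single (i j : Fin n) (a : selfAdjoint (Matrix (Fin k) (Fin k) ℂ)) :
    (single i a).mat j = if j = i then (a : Matrix (Fin k) (Fin k) ℂ) else 0 := by
  by_cases h : j = i
  · subst h
    simp [single, mat]
  · simp [single, mat, h]

theorem trace_mul_selfAdjoint_re (x : HermTuple n k) (i : Fin n)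
    (a : selfAdjoint (Matrix (Fin k) (Fin k) ℂ)) :
    (((x.mat i * (a : Matrix (Fin k) (Fin k) ℂ)).trace.re : ℝ) : ℂ) =
      (x.mat i * (a : Matrix (Fin k) (Fin k) ℂ)).trace := by
  rw [← Complex.conj_eq_iff_re, ← Complex.star_def, ← Matrix.trace_conjTranspose,
    Matrix.conjTranspose_mul, conjTranspose_mat, Matrix.trace_mul_comm]
  have : (a : Matrix (Fin k) (Fin k) ℂ).conjTranspose = a := a.2
  rw [this]

theorem inner_single (x : HermTuple n k) (i : Fin n)
    (a : selfAdjoint (Matrix (Fin k) (Fin k) ℂ)) :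
    ((inner ℝ x (single i a) : ℝ) : ℂ) = (x.mat i * (a : Matrix (Fin k) (Fin k) ℂ)).trace := by
  rw [← trace_mul_selfAdjoint_re, inner_eq]
  congr 1
  rw [Finset.sum_eq_single i]
  · simp [mat_single]
  · intro j _ hj
    simp [mat_single, hj]
  · simp

/-- The entries of the matrices of a tuple, as linear functionals. -/
noncomputable def entry (i : Fin n) (a b : Fin k) : HermTuple n k →ₗ[ℝ] ℂ where
  toFun x := x.mat i a b
  map_add' x y := by simp [mat_add]
  map_smul' r x := by simp [mat_smul]

theorem polyGrowth_mat (i : Fin n) (a b : Fin k) :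
    PolyGrowth fun x : HermTuple n k => x.mat i a b := by
  refine ⟨(entry i a b).continuous_of_finiteDimensional, 1, 1, fun x => ?_⟩
  have := norm_mat_apply_le x i a b
  linarith

theorem polyGrowth_word (w : List (Fin n)) (a b : Fin k) :
    PolyGrowth fun x : HermTuple n k => x.word w a b := by
  induction w generalizing a with
  | nil => exact .const _
  | cons i w ih =>
    simp only [word_cons, Matrix.mul_apply]
    exact .sum _ fun c _ => (polyGrowth_mat i a c).mul (ih c)

theorem polyGrowth_normTrace_word (w : List (Fin n)) :
    PolyGrowth fun x : HermTuple n k => normTrace (x.word w) := by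
  simp only [normTrace, Matrix.trace, Matrix.diag, div_eq_mul_inv]
  exact (PolyGrowth.sum _ fun a _ => polyGrowth_word w a a).mul (.const _)

theorem polyGrowth_trProd (L : List (List (Fin n))) :
    PolyGrowth (trProd L : HermTuple n k → ℂ) := by
  induction L with
  | nil => exact .const 1
  | cons w L ih =>
    have : (trProd (w :: L) : HermTuple n k → ℂ) =
        fun x => normTrace (x.word w) * trProd L x := funext fun x => trProd_cons w L x
    rw [this]
    exact (polyGrowth_normTrace_word w).mul ih

/-- The derivative of a word in the `i`-th matrix, in the direction of an arbitrary complex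
matrix. -/
noncomputable def dWord (i : Fin n) (H : Matrix (Fin k) (Fin k) ℂ) (w : List (Fin n))
    (x : HermTuple n k) : Matrix (Fin k) (Fin k) ℂ :=
  splitSum i w fun u v => x.word u * H * x.word v

theorem dWord_cons (i j : Fin n) (H : Matrix (Fin k) (Fin k) ℂ) (w : List (Fin n))
    (x : HermTuple n k) :
    dWord i H (j :: w) x = (if j = i then H else 0) * x.word w + x.mat j * dWord i H w x := by
  rw [dWord, splitSum_cons, dWord, mul_splitSum]
  congr 1
  · split_ifs <;> simp
  · simp [word_cons, mul_assoc]

theorem dWord_add_smul (i : Fin n) (H K : Matrix (Fin k) (Fin k) ℂ) (c : ℂ) (w : List (Fin n))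
    (x : HermTuple n k) : dWord i (H + c • K) w x = dWord i H w x + c • dWord i K w x := by
  induction w with
  | nil => simp [dWord]
  | cons j w ih =>
    simp only [dWord_cons, ih]
    split_ifs
    · rw [add_mul, mul_add, smul_add, smul_mul_assoc, mul_smul_comm]
      abel
    · simp [mul_add]

/-- The derivative of a product of normalized traces of words in the `i`-th matrix, in the
direction of an arbitrary complex matrix. -/
noncomputable def dTrProd (i : Fin n) (H : Matrix (Fin k) (Fin k) ℂ) (L : List (List (Fin n)))
    (x : HermTuple n k) : ℂ :=
  ∑ q : Fin L.length, normTrace (dWord i H (L.get q) x) * trProd (L.eraseIdx q) x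

theorem dTrProd_cons (i : Fin n) (H : Matrix (Fin k) (Fin k) ℂ) (w : List (Fin n))
    (L : List (List (Fin n))) (x : HermTuple n k) :
    dTrProd i H (w :: L) x =
      normTrace (dWord i H w x) * trProd L x + normTrace (x.word w) * dTrProd i H L x := by
  have : dTrProd i H (w :: L) x = ∑ q : Fin (L.length + 1),
    normTrace (dWord i H ((w :: L).get q) x) * trProd ((w :: L).eraseIdx q) x := rfl
  rw [this, Fin.sum_univ_succ, dTrProd, Finset.mul_sum]
  congr 1
  refine Finset.sum_congr rfl fun q _ => ?_
  simp only [Fin.val_succ, List.eraseIdx_cons_succ, trProd_cons]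
  exact mul_left_comm _ _ _

theorem normTrace_add_smul (A B : Matrix (Fin k) (Fin k) ℂ) (c : ℂ) :
    normTrace (A + c • B) = normTrace A + c * normTrace B := by
  simp only [normTrace, Matrix.trace_add, Matrix.trace_smul, smul_eq_mul]
  ring

theorem dTrProd_add_smul (i : Fin n) (H K : Matrix (Fin k) (Fin k) ℂ) (c : ℂ)
    (L : List (List (Fin n))) (x : HermTuple n k) :
    dTrProd i (H + c • K) L x = dTrProd i H L x + c * dTrProd i K L x := by
  simp only [dTrProd, dWord_add_smul, normTrace_add_smul, add_mul, Finset.sum_add_distrib,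
    Finset.mul_sum, mul_assoc]

theorem hasLineDerivAt_word (i : Fin n) (h : selfAdjoint (Matrix (Fin k) (Fin k) ℂ))
    (w : List (Fin n)) (a b : Fin k) (x : HermTuple n k) :
    HasLineDerivAt ℝ (fun x : HermTuple n k => x.word w a b) (dWord i h w x a b) x
      (single i h) := by
  induction w generalizing a with
  | nil => exact hasDerivAt_const (0 : ℝ) ((1 : Matrix (Fin k) (Fin k) ℂ) a b)
  | cons j w ih =>
    have hm : ∀ c, HasDerivAt (fun t : ℝ => (x + t • single i h).mat j a c)
        ((single i h).mat j a c) 0 := by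
      intro c
      have : ∀ t : ℝ, (x + t • single i h).mat j a c =
          x.mat j a c + t • (single i h).mat j a c := fun t => by
        simp [mat_add, mat_smul]
      simp only [this]
      refine (((hasDerivAt_id (0 : ℝ)).smul_const _).const_add _).congr_deriv ?_
      exact one_smul _ _
    have key := HasDerivAt.fun_sum fun c (_ : c ∈ Finset.univ) => (hm c).mul (ih c)
    unfold HasLineDerivAt
    simp only [word_cons, Matrix.mul_apply]
    refine key.congr_deriv ?_
    simp only [dWord_cons, Matrix.add_apply, Matrix.mul_apply, mat_single, Finset.sum_add_distrib,
      zero_smul, add_zero]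

theorem hasLineDerivAt_trProd (i : Fin n) (h : selfAdjoint (Matrix (Fin k) (Fin k) ℂ))
    (L : List (List (Fin n))) (x : HermTuple n k) :
    HasLineDerivAt ℝ (trProd L : HermTuple n k → ℂ) (dTrProd i h L x) x (single i h) := by
  induction L with
  | nil =>
    have h0 : dTrProd i (h : Matrix (Fin k) (Fin k) ℂ) [] x = 0 := Finset.sum_empty
    rw [h0]
    exact hasDerivAt_const (0 : ℝ) (1 : ℂ)
  | cons w L ih =>
    have h1 : HasDerivAt (fun t : ℝ => normTrace ((x + t • single i h).word w))
        (normTrace (dWord i h w x)) 0 :=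
      (HasDerivAt.fun_sum fun a (_ : a ∈ Finset.univ) =>
        hasLineDerivAt_word i h w a a x).div_const _
    have h2 := h1.mul ih
    unfold HasLineDerivAt
    simp only [trProd_cons]
    refine h2.congr_deriv ?_
    simp [dTrProd_cons]

theorem polyGrowth_dWord (i : Fin n) (H : Matrix (Fin k) (Fin k) ℂ) (w : List (Fin n))
    (a b : Fin k) : PolyGrowth fun x : HermTuple n k => dWord i H w x a b := by
  induction w generalizing a with
  | nil => simpa [dWord] using PolyGrowth.const (E := HermTuple n k) 0
  | cons j w ih =>
    simp only [dWord_cons, Matrix.add_apply, Matrix.mul_apply]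
    exact (PolyGrowth.sum _ fun c _ => (PolyGrowth.const _).mul (polyGrowth_word w c b)).add
      (.sum _ fun c _ => (polyGrowth_mat j a c).mul (ih c))

theorem polyGrowth_dTrProd (i : Fin n) (H : Matrix (Fin k) (Fin k) ℂ) (L : List (List (Fin n))) :
    PolyGrowth (dTrProd i H L : HermTuple n k → ℂ) := by
  unfold dTrProd
  simp only [normTrace, Matrix.trace, Matrix.diag, div_eq_mul_inv]
  exact .sum _ fun q _ => ((PolyGrowth.sum _ fun a _ => polyGrowth_dWord i H _ a a).mul
    (.const _)).mul (polyGrowth_trProd _)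

/-- The centered Gaussian measure on tuples of selfadjoint `k × k` matrices, normalized so that
the entries have variance `1 / k`: independent matrices of the Gaussian unitary ensemble. -/
noncomputable abbrev gue (n k : ℕ) : Measure (HermTuple n k) := gaussianMeasure (HermTuple n k) k

/-- Gaussian integration by parts, in the direction of an arbitrary complex matrix. -/
theorem integral_trace_mul (hk : 1 ≤ k) (i : Fin n) (H : Matrix (Fin k) (Fin k) ℂ)
    (w : List (Fin n)) (a b : Fin k) (L : List (List (Fin n))) :
    ∫ x, (x.mat i * H).trace * (x.word w a b * trProd L x) ∂gue n k =
      (k : ℂ)⁻¹ * ∫ x, (dWord i H w x a b * trProd L x + x.word w a b * dTrProd i H L x)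
        ∂gue n k := by
  have hk0 : (0 : ℝ) < k := by exact_mod_cast hk
  have hpg : ∀ K : Matrix (Fin k) (Fin k) ℂ, PolyGrowth fun x : HermTuple n k =>
      dWord i K w x a b * trProd L x + x.word w a b * dTrProd i K L x := fun K =>
    ((polyGrowth_dWord i K w a b).mul (polyGrowth_trProd L)).add
      ((polyGrowth_word w a b).mul (polyGrowth_dTrProd i K L))
  have hpt : ∀ K : Matrix (Fin k) (Fin k) ℂ, PolyGrowth fun x : HermTuple n k =>
      (x.mat i * K).trace * (x.word w a b * trProd L x) := fun K => by
    simp only [Matrix.trace, Matrix.diag, Matrix.mul_apply]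
    exact (PolyGrowth.sum _ fun c _ => .sum _ fun d _ => (polyGrowth_mat i c d).mul (.const _)).mul
      ((polyGrowth_word w a b).mul (polyGrowth_trProd L))
  have key : ∀ h : selfAdjoint (Matrix (Fin k) (Fin k) ℂ),
      ∫ x, (x.mat i * (h : Matrix (Fin k) (Fin k) ℂ)).trace * (x.word w a b * trProd L x)
        ∂gue n k =
      (k : ℂ)⁻¹ * ∫ x, (dWord i h w x a b * trProd L x + x.word w a b * dTrProd i h L x)
        ∂gue n k := by
    intro h
    have := integral_inner_mul_gaussianMeasure hk0
      ((polyGrowth_word w a b).mul (polyGrowth_trProd L)) (hpg h) (single i h) fun x => by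
        have := (hasLineDerivAt_word i h w a b x).mul (hasLineDerivAt_trProd i h L x)
        unfold HasLineDerivAt
        refine this.congr_deriv ?_
        simp
    simpa [inner_single] using this
  -- Both sides are complex linear in `H`.
  obtain ⟨p, q, rfl⟩ : ∃ p q : selfAdjoint (Matrix (Fin k) (Fin k) ℂ),
      H = (p : Matrix (Fin k) (Fin k) ℂ) + Complex.I • (q : Matrix (Fin k) (Fin k) ℂ) :=
    ⟨realPart H, imaginaryPart H, (realPart_add_I_smul_imaginaryPart H).symm⟩
  have e1 : ∀ x : HermTuple n k, (x.mat i * ((p : Matrix (Fin k) (Fin k) ℂ) +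
      Complex.I • (q : Matrix (Fin k) (Fin k) ℂ))).trace * (x.word w a b * trProd L x) =
      (x.mat i * (p : Matrix (Fin k) (Fin k) ℂ)).trace * (x.word w a b * trProd L x) +
      Complex.I * ((x.mat i * (q : Matrix (Fin k) (Fin k) ℂ)).trace *
        (x.word w a b * trProd L x)) := fun x => by
    rw [mul_add, mul_smul_comm, Matrix.trace_add, Matrix.trace_smul, smul_eq_mul]
    ring
  have e2 : ∀ x : HermTuple n k, dWord i ((p : Matrix (Fin k) (Fin k) ℂ) +
      Complex.I • (q : Matrix (Fin k) (Fin k) ℂ)) w x a b * trProd L x +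
      x.word w a b * dTrProd i ((p : Matrix (Fin k) (Fin k) ℂ) +
      Complex.I • (q : Matrix (Fin k) (Fin k) ℂ)) L x =
      (dWord i p w x a b * trProd L x + x.word w a b * dTrProd i p L x) +
      Complex.I * (dWord i q w x a b * trProd L x + x.word w a b * dTrProd i q L x) := fun x => by
    rw [dWord_add_smul, dTrProd_add_smul, Matrix.add_apply, Matrix.smul_apply, smul_eq_mul]
    ring
  simp only [e1, e2]
  rw [integral_add ((hpt p).integrable hk0) (((hpt q).integrable hk0).const_mul _),
    integral_add ((hpg p).integrable hk0) (((hpg q).integrable hk0).const_mul _),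
    integral_const_mul, integral_const_mul, key p, key q]
  ring

theorem mul_single_mul_apply (A B : Matrix (Fin k) (Fin k) ℂ) (a b p q : Fin k) :
    (A * Matrix.single b a (1 : ℂ) * B) p q = A p b * B a q := by
  rw [mul_assoc, Matrix.mul_apply, Finset.sum_eq_single b]
  · simp
  · intro c _ hc
    simp [hc]
  · simp

theorem sum_dWord_single (i : Fin n) (w : List (Fin n)) (x : HermTuple n k) :
    ∑ a, ∑ b, dWord i (Matrix.single b a 1) w x b a =
      splitSum i w fun u v => (x.word u).trace * (x.word v).trace := by
  have e : ∀ (H : Matrix (Fin k) (Fin k) ℂ) (a b : Fin k), dWord i H w x a b =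
      splitSum i w fun u v => (x.word u * H * x.word v) a b := fun H a b =>
    map_splitSum (Matrix.entryAddMonoidHom ℂ a b) i w fun u v => x.word u * H * x.word v
  simp only [e, mul_single_mul_apply, splitSum, Matrix.trace, Matrix.diag]
  simp only [Finset.sum_comm (s := Finset.univ (α := Fin k)) (t := Finset.range w.length)]
  refine Finset.sum_congr rfl fun p _ => ?_
  split_ifs
  · rw [Finset.sum_mul_sum, Finset.sum_comm]
  · simp

theorem sum_mul_normTrace_dWord_single (C : Matrix (Fin k) (Fin k) ℂ) (i : Fin n)
    (w : List (Fin n)) (x : HermTuple n k) :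
    ∑ a, ∑ b, C b a * normTrace (dWord i (Matrix.single b a 1) w x) =
      splitSum i w fun u v => normTrace (C * x.word v * x.word u) := by
  have e : ∀ (H : Matrix (Fin k) (Fin k) ℂ), normTrace (dWord i H w x) =
      splitSum i w fun u v => normTrace (x.word u * H * x.word v) := fun H =>
    map_splitSum (AddMonoidHom.mk' (normTrace : Matrix (Fin k) (Fin k) ℂ → ℂ) fun A B => by
      simp [normTrace, add_div]) i w _
  have e2 : ∀ (A B : Matrix (Fin k) (Fin k) ℂ) (a b : Fin k),
      (A * Matrix.single b a (1 : ℂ) * B).trace = (B * A) a b := by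
    intro A B a b
    rw [Matrix.mul_apply]
    simp only [Matrix.trace, Matrix.diag, mul_single_mul_apply]
    exact Finset.sum_congr rfl fun _ _ => mul_comm _ _
  simp only [e, mul_splitSum]
  simp only [splitSum, normTrace, e2]
  simp only [Finset.sum_comm (s := Finset.univ (α := Fin k)) (t := Finset.range w.length)]
  refine Finset.sum_congr rfl fun p _ => ?_
  split_ifs
  · rw [mul_assoc, Matrix.trace, Finset.sum_div, Finset.sum_comm]
    refine Finset.sum_congr rfl fun b _ => ?_
    rw [Matrix.diag, Matrix.mul_apply, Finset.sum_div]
    exact Finset.sum_congr rfl fun a _ => (mul_div_assoc _ _ _).symm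
  · simp

theorem integral_splitSum {μ : Measure (HermTuple n k)} (i : Fin n) (w : List (Fin n))
    {f : List (Fin n) → List (Fin n) → HermTuple n k → ℂ} (hf : ∀ u v, Integrable (f u v) μ) :
    ∫ x, splitSum i w (fun u v => f u v x) ∂μ = splitSum i w fun u v => ∫ x, f u v x ∂μ := by
  unfold splitSum
  rw [integral_finsetSum]
  · refine Finset.sum_congr rfl fun p _ => ?_
    split_ifs <;> simp
  · intro p _
    split_ifs
    · exact hf _ _
    · exact integrable_zero _ _ _

/-- The Schwinger–Dyson equation for products of traces of Gaussian random matrices. -/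
theorem integral_trProd_cons (hk : 1 ≤ k) (i : Fin n) (w : List (Fin n))
    (L : List (List (Fin n))) :
    ∫ x, trProd ((i :: w) :: L) x ∂gue n k =
      splitSum i w (fun u v => ∫ x, trProd (u :: v :: L) x ∂gue n k) +
      ((k : ℂ) ^ 2)⁻¹ * ∑ q : Fin L.length, splitSum i (L.get q) fun u v =>
        ∫ x, trProd ((w ++ v ++ u) :: L.eraseIdx q) x ∂gue n k := by
  have hk0 : (0 : ℝ) < k := by exact_mod_cast hk
  have hkC : (k : ℂ) ≠ 0 := by exact_mod_cast hk0.ne'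
  have e1 : ∀ x : HermTuple n k, trProd ((i :: w) :: L) x = (k : ℂ)⁻¹ * ∑ a, ∑ b,
      (x.mat i * Matrix.single b a (1 : ℂ)).trace * (x.word w b a * trProd L x) := by
    intro x
    rw [trProd_cons, normTrace, word_cons, Matrix.trace]
    simp only [Matrix.diag, Matrix.mul_apply, Matrix.trace_mul_single]
    rw [div_mul_eq_mul_div, div_eq_inv_mul, Finset.sum_mul]
    congr 1
    refine Finset.sum_congr rfl fun a _ => ?_
    rw [Finset.sum_mul]
    exact Finset.sum_congr rfl fun b _ => by simp [mul_assoc]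
  have e2 : ∀ x : HermTuple n k, ∑ a, ∑ b, (dWord i (Matrix.single b a 1) w x b a * trProd L x +
      x.word w b a * dTrProd i (Matrix.single b a 1) L x) =
      splitSum i w (fun u v => (k : ℂ) ^ 2 * trProd (u :: v :: L) x) +
      ∑ q : Fin L.length, splitSum i (L.get q) fun u v =>
        trProd ((w ++ v ++ u) :: L.eraseIdx q) x := by
    intro x
    simp only [Finset.sum_add_distrib, ← Finset.sum_mul]
    rw [sum_dWord_single, splitSum_mul]
    congr 1
    · refine splitSum_congr fun u v _ => ?_
      simp only [trProd_cons, normTrace]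
      field_simp
    · simp only [dTrProd, Finset.mul_sum]
      simp only [Finset.sum_comm (s := Finset.univ (α := Fin k))
        (t := Finset.univ (α := Fin L.length))]
      refine Finset.sum_congr rfl fun q _ => ?_
      simp only [← mul_assoc, ← Finset.sum_mul, sum_mul_normTrace_dWord_single, splitSum_mul]
      exact splitSum_congr fun u v _ => by rw [trProd_cons, word_append, word_append]
  have hpg : ∀ a b : Fin k, Integrable (fun x : HermTuple n k =>
      dWord i (Matrix.single b a 1) w x b a * trProd L x +
      x.word w b a * dTrProd i (Matrix.single b a 1) L x) (gue n k) := fun a b =>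
    (((polyGrowth_dWord i _ w b a).mul (polyGrowth_trProd L)).add
      ((polyGrowth_word w b a).mul (polyGrowth_dTrProd i _ L))).integrable hk0
  have hpt : ∀ a b : Fin k, Integrable (fun x : HermTuple n k =>
      (x.mat i * Matrix.single b a (1 : ℂ)).trace * (x.word w b a * trProd L x)) (gue n k) :=
    fun a b => by
    refine PolyGrowth.integrable hk0 ?_
    simp only [Matrix.trace_mul_single]
    exact PolyGrowth.mul (by simpa using polyGrowth_mat i a b)
      ((polyGrowth_word w b a).mul (polyGrowth_trProd L))
  have hint : ∀ L' : List (List (Fin n)),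
      Integrable (fun x : HermTuple n k => trProd L' x) (gue n k) := fun L' =>
    (polyGrowth_trProd L').integrable hk0
  have hsplit : ∀ (w' : List (Fin n)) (g : List (Fin n) → List (Fin n) → HermTuple n k → ℂ),
      (∀ u v, PolyGrowth (g u v)) →
      Integrable (fun x => splitSum i w' fun u v => g u v x) (gue n k) := fun w' g hg =>
    (PolyGrowth.splitSum i w' hg).integrable hk0
  have hpgL : ∀ u v : List (Fin n), PolyGrowth fun x : HermTuple n k =>
      (k : ℂ) ^ 2 * trProd (u :: v :: L) x := fun u v =>
    (PolyGrowth.const _).mul (polyGrowth_trProd _)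
  calc ∫ x, trProd ((i :: w) :: L) x ∂gue n k
      = (k : ℂ)⁻¹ * ∑ a, ∑ b, ∫ x, (x.mat i * Matrix.single b a (1 : ℂ)).trace *
          (x.word w b a * trProd L x) ∂gue n k := by
        simp only [e1]
        rw [integral_const_mul, integral_finsetSum _ fun a _ =>
          integrable_finsetSum _ fun b _ => hpt a b]
        congr 1
        exact Finset.sum_congr rfl fun a _ => integral_finsetSum _ fun b _ => hpt a b
    _ = (k : ℂ)⁻¹ * ((k : ℂ)⁻¹ * ∫ x, ∑ a, ∑ b, (dWord i (Matrix.single b a 1) w x b a *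
          trProd L x + x.word w b a * dTrProd i (Matrix.single b a 1) L x) ∂gue n k) := by
        rw [integral_finsetSum _ fun a _ => integrable_finsetSum _ fun b _ => hpg a b]
        simp only [integral_trace_mul hk, ← Finset.mul_sum]
        congr 2
        exact Finset.sum_congr rfl fun a _ => (integral_finsetSum _ fun b _ => hpg a b).symm
    _ = _ := by
        simp only [e2]
        rw [integral_add (hsplit _ _ hpgL) (integrable_finsetSum _ fun q _ =>
            hsplit _ _ fun u v => polyGrowth_trProd _),
          integral_splitSum i w fun u v => (hpgL u v).integrable hk0,
          integral_finsetSum _ fun q _ => hsplit _ _ fun u v => polyGrowth_trProd _]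
        simp only [integral_const_mul, ← mul_splitSum]
        rw [Finset.sum_congr rfl fun q _ => integral_splitSum i _ fun u v => hint _]
        field_simp

theorem _root_.tendsto_splitSum {ι : Type*} [DecidableEq ι] (i : ι) (w : List ι)
    {f : ℕ → List ι → List ι → ℂ} {g : List ι → List ι → ℂ}
    (h : ∀ u v, u.length + v.length + 1 = w.length →
      Tendsto (fun k => f k u v) atTop (𝓝 (g u v))) :
    Tendsto (fun k => splitSum i w (f k)) atTop (𝓝 (splitSum i w g)) := by
  refine tendsto_finsetSum _ fun p hp => ?_
  have hp := Finset.mem_range.1 hp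
  split_ifs
  · exact h _ _ (by simp; omega)
  · exact tendsto_const_nhds

/-- Expectations of products of traces of Gaussian random matrices converge to the products of the
moments determined by the Schwinger–Dyson equation: products of traces decouple, because the
terms coupling two traces carry the factor `k⁻²`. -/
theorem tendsto_integral_trProd {τ : List (Fin n) → ℂ} (h0 : τ [] = 1)
    (hτ : ∀ i w, τ (i :: w) = splitSum i w fun u v => τ u * τ v) (L : List (List (Fin n))) :
    Tendsto (fun k : ℕ => ∫ x, trProd L x ∂gue n k) atTop (𝓝 (L.map τ).prod) := by
  -- Each word counts once more than its length: then removing an empty word, and removing two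
  -- letters and splitting the word, both decrease the size.
  induction hN : (L.map fun w => w.length + 1).sum using Nat.strong_induction_on
    generalizing L with
  | _ N ih =>
    subst hN
    match L with
    | [] =>
      refine tendsto_const_nhds.congr' ?_
      filter_upwards [eventually_ge_atTop 1] with k hk
      have := isProbabilityMeasure_gaussianMeasure (E := HermTuple n k)
        (c := k) (by exact_mod_cast hk)
      simp
    | [] :: L =>
      have := ih _ (by simp) L rfl
      simp only [List.map_cons, List.prod_cons, h0, one_mul]
      refine this.congr' ?_
      filter_upwards [eventually_ge_atTop 1] with k hk
      have hk0 : (k : ℂ) ≠ 0 := by exact_mod_cast (by omega : k ≠ 0)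
      simp [trProd_cons, normTrace, hk0]
    | (i :: w) :: L =>
      have h1 : Tendsto (fun k : ℕ => splitSum i w fun u v => ∫ x, trProd (u :: v :: L) x ∂gue n k)
          atTop (𝓝 (splitSum i w fun u v => τ u * τ v * (L.map τ).prod)) := by
        refine tendsto_splitSum i w fun u v huv => ?_
        have := ih _ (by simp; omega) (u :: v :: L) rfl
        simpa [mul_assoc] using this
      have h2 : Tendsto (fun k : ℕ => ∑ q : Fin L.length, splitSum i (L.get q) fun u v =>
          ∫ x, trProd ((w ++ v ++ u) :: L.eraseIdx q) x ∂gue n k) atTop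
          (𝓝 (∑ q : Fin L.length, splitSum i (L.get q) fun u v =>
            τ (w ++ v ++ u) * ((L.eraseIdx q).map τ).prod)) := by
        refine tendsto_finsetSum _ fun q _ => tendsto_splitSum i _ fun u v huv => ?_
        have hsum : (L.map fun w => w.length + 1).sum =
            ((L.get q).length + 1) + ((L.eraseIdx q).map fun w => w.length + 1).sum := by
          exact (((List.getElem_cons_eraseIdx_perm q.2).map fun w => w.length + 1).sum_eq).symm
        have := ih _ (by simp at hsum huv ⊢; omega) ((w ++ v ++ u) :: L.eraseIdx q) rfl
        simpa using this
      have h3 : Tendsto (fun k : ℕ => ((k : ℂ) ^ 2)⁻¹) atTop (𝓝 0) := by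
        simpa using (tendsto_inv_atTop_nhds_zero_nat (𝕜 := ℂ)).pow 2
      have h4 := h1.add (h3.mul h2)
      rw [zero_mul, add_zero, ← splitSum_mul, ← hτ] at h4
      refine Tendsto.congr' ?_ h4
      filter_upwards [eventually_ge_atTop 1] with k hk
      exact (integral_trProd_cons hk i w L).symm

end HermTuple

/-! ### Operator norms of Gaussian random matrices -/

section OpNorm

/-- The operator norm is controlled by the values of the sesquilinear form on a net of the unit
ball. -/
theorem ContinuousLinearMap.opNorm_le_of_net {E : Type*} [NormedAddCommGroup E]
    [InnerProductSpace ℂ E] (A : E →L[ℂ] E) (N : Finset E) (hN : ∀ u ∈ N, ‖u‖ ≤ 1)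
    (hnet : ∀ u : E, ‖u‖ ≤ 1 → ∃ v ∈ N, dist u v ≤ 1 / 4) {t : ℝ}
    (ht : ∀ u ∈ N, ∀ v ∈ N, (inner ℂ v (A u)).re ≤ t) : ‖A‖ ≤ 2 * t := by
  have h1 : ∀ u v : E, ‖u‖ ≤ 1 → ‖v‖ ≤ 1 → (inner ℂ v (A u)).re ≤ t + ‖A‖ / 2 := by
    intro u v hu hv
    obtain ⟨u', hu', hdu⟩ := hnet u hu
    obtain ⟨v', hv', hdv⟩ := hnet v hv
    have e : inner ℂ v (A u) =
        inner ℂ v' (A u') + inner ℂ v' (A (u - u')) + inner ℂ (v - v') (A u) := by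
      rw [map_sub, inner_sub_right, inner_sub_left]
      ring
    rw [dist_eq_norm] at hdu hdv
    have b1 : (inner ℂ v' (A (u - u'))).re ≤ ‖A‖ / 4 :=
      calc (inner ℂ v' (A (u - u'))).re ≤ ‖v'‖ * ‖A (u - u')‖ :=
            (Complex.re_le_norm _).trans (norm_inner_le_norm _ _)
        _ ≤ 1 * (‖A‖ * (1 / 4)) := by
            gcongr
            · exact hN v' hv'
            · exact (A.le_opNorm _).trans (by gcongr)
        _ = ‖A‖ / 4 := by ring
    have b2 : (inner ℂ (v - v') (A u)).re ≤ ‖A‖ / 4 :=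
      calc (inner ℂ (v - v') (A u)).re ≤ ‖v - v'‖ * ‖A u‖ :=
            (Complex.re_le_norm _).trans (norm_inner_le_norm _ _)
        _ ≤ 1 / 4 * (‖A‖ * 1) := by
            gcongr
            exact (A.le_opNorm _).trans (by gcongr)
        _ = ‖A‖ / 4 := by ring
    rw [e, Complex.add_re, Complex.add_re]
    linarith [ht u' hu' v' hv']
  have h0 : 0 ≤ t + ‖A‖ / 2 := by simpa using h1 0 0 (by simp) (by simp)
  have h2 : ‖A‖ ≤ t + ‖A‖ / 2 := by
    refine A.opNorm_le_bound h0 fun u => ?_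
    by_cases hu : u = 0
    · simp [hu]
    by_cases hA : A u = 0
    · rw [hA, norm_zero]
      positivity
    have hu' : 0 < ‖u‖ := norm_pos_iff.2 hu
    have hA' : 0 < ‖A u‖ := norm_pos_iff.2 hA
    have h3 := h1 (((‖u‖⁻¹ : ℝ) : ℂ) • u) (((‖A u‖⁻¹ : ℝ) : ℂ) • A u)
      (by rw [norm_smul, Complex.norm_real, norm_inv, norm_norm, inv_mul_cancel₀ hu'.ne'])
      (by rw [norm_smul, Complex.norm_real, norm_inv, norm_norm, inv_mul_cancel₀ hA'.ne'])
    rw [map_smul, inner_smul_left, inner_smul_right, inner_self_eq_norm_sq_to_K,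
      Complex.conj_ofReal] at h3
    have e : ((‖A u‖⁻¹ : ℝ) : ℂ) * (((‖u‖⁻¹ : ℝ) : ℂ) * ((‖A u‖ : ℝ) : ℂ) ^ 2) =
        ((‖A u‖ / ‖u‖ : ℝ) : ℂ) := by
      rw [← Complex.ofReal_pow, ← Complex.ofReal_mul, ← Complex.ofReal_mul]
      congr 1
      field_simp
    have h4 : ‖A u‖ / ‖u‖ ≤ t + ‖A‖ / 2 := by
      rw [← Complex.ofReal_re (‖A u‖ / ‖u‖), ← e]
      exact h3
    rwa [div_le_iff₀ hu'] at h4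
  linarith

theorem gaussianMeasure_le_of_abs_le_norm {E : Type*} [NormedAddCommGroup E]
    [InnerProductSpace ℝ E] [FiniteDimensional ℝ E] [MeasurableSpace E] [BorelSpace E] {c t : ℝ}
    (hc : 0 < c) (ht : 0 ≤ t) (l : E →ₗ[ℝ] ℝ) (hl : ∀ x, |l x| ≤ ‖x‖) :
    gaussianMeasure E c {x | t ≤ l x} ≤ ENNReal.ofReal (Real.exp (-(c * t ^ 2 / 2))) := by
  let l' : StrongDual ℝ E := l.toContinuousLinearMap
  have h1 : ‖(InnerProductSpace.toDual ℝ E).symm l'‖ ≤ 1 := by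
    rw [LinearIsometryEquiv.norm_map]
    exact l'.opNorm_le_bound zero_le_one fun x =>
      (hl x).trans_eq (one_mul _).symm
  have h2 := gaussianMeasure_halfSpace_le hc h1 ht
  simp only [InnerProductSpace.toDual_symm_apply] at h2
  exact h2

end OpNorm

namespace HermTuple

variable {n k : ℕ}

theorem norm_toEuclideanCLM_apply_le (x : HermTuple n k) (i : Fin n)
    (u : EuclideanSpace ℂ (Fin k)) :
    ‖Matrix.toEuclideanCLM (n := Fin k) (𝕜 := ℂ) (x.mat i) u‖ ≤ ‖x‖ * ‖u‖ := by
  refine le_of_sq_le_sq ?_ (by positivity)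
  have h1 : ∑ a, ∑ b, ‖x.mat i a b‖ ^ 2 ≤ ‖x‖ ^ 2 := by
    rw [norm_sq_eq]
    exact Finset.single_le_sum (f := fun i => ∑ a, ∑ b, ‖x.mat i a b‖ ^ 2)
      (fun i _ => by positivity) (Finset.mem_univ i)
  rw [mul_pow, EuclideanSpace.norm_sq_eq, EuclideanSpace.norm_sq_eq]
  refine le_trans ?_ (mul_le_mul_of_nonneg_right h1 (by positivity))
  rw [Finset.sum_mul]
  refine Finset.sum_le_sum fun a _ => ?_
  have e : Matrix.toEuclideanCLM (n := Fin k) (𝕜 := ℂ) (x.mat i) u a = ∑ b, x.mat i a b * u b := by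
    rw [Matrix.ofLp_toEuclideanCLM]
    rfl
  rw [e]
  refine le_trans (pow_le_pow_left₀ (norm_nonneg _) (norm_sum_le _ _) 2) ?_
  simp only [norm_mul]
  exact Finset.sum_mul_sq_le_sq_mul_sq _ _ _

/-- A union bound over pairs of points of a `1 / 4`-net with at most `9 ^ (2 k)` points; the
constant `10` is large enough for `6561 * exp (-25 / 2) < 1`, where `6561 = 9 ^ 4`. -/
theorem gue_opNorm_le (hk : 1 ≤ k) (i : Fin n) :
    gue n k {x | 10 < ‖Matrix.toEuclideanCLM (n := Fin k) (𝕜 := ℂ) (x.mat i)‖} ≤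
      ENNReal.ofReal (6561 * Real.exp (-(25 / 2))) ^ k := by
  have hk0 : (0 : ℝ) < k := by exact_mod_cast hk
  obtain ⟨N, hN, hnet, hcard⟩ := exists_finset_net (E := EuclideanSpace ℂ (Fin k)) (ρ := 1)
    (δ := 1 / 4) zero_le_one (by norm_num) {u | ‖u‖ ≤ 1} fun u hu => hu
  have hfr : Module.finrank ℝ (EuclideanSpace ℂ (Fin k)) = 2 * k := by
    rw [finrank_real_of_complex, finrank_euclideanSpace_fin]
  rw [hfr] at hcard
  let l : EuclideanSpace ℂ (Fin k) → EuclideanSpace ℂ (Fin k) → HermTuple n k →ₗ[ℝ] ℝ := fun u v =>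
    { toFun := fun x => (inner ℂ v (Matrix.toEuclideanCLM (n := Fin k) (𝕜 := ℂ) (x.mat i) u)).re
      map_add' := fun x y => by
        rw [mat_add, map_add, add_apply, inner_add_right, Complex.add_re]
      map_smul' := fun r x => by
        have : r • x.mat i = (r : ℂ) • x.mat i := by
          ext a b
          simp
        rw [mat_smul, this, map_smul, smul_apply, inner_smul_right,
          Complex.re_ofReal_mul]
        rfl }
  have hl : ∀ u ∈ N, ∀ v ∈ N, ∀ x, |l u v x| ≤ ‖x‖ := by
    intro u hu v hv x
    calc |l u v x| ≤ ‖v‖ * ‖Matrix.toEuclideanCLM (n := Fin k) (𝕜 := ℂ) (x.mat i) u‖ :=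
          (Complex.abs_re_le_norm _).trans (norm_inner_le_norm _ _)
      _ ≤ 1 * (‖x‖ * 1) := by
          gcongr
          · exact hN v hv
          · exact (norm_toEuclideanCLM_apply_le x i u).trans (by gcongr; exact hN u hu)
      _ = ‖x‖ := by ring
  have hsub : {x : HermTuple n k | 10 < ‖Matrix.toEuclideanCLM (n := Fin k) (𝕜 := ℂ) (x.mat i)‖} ⊆
      ⋃ p ∈ N ×ˢ N, {x | 5 ≤ l p.1 p.2 x} := by
    intro x hx
    by_contra hnot
    simp only [Set.mem_iUnion, not_exists] at hnot
    refine absurd (ContinuousLinearMap.opNorm_le_of_net _ N hN hnet (t := 5) fun u hu v hv => ?_)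
      (by norm_num; exact hx)
    exact (not_le.1 (hnot (u, v) (Finset.mk_mem_product hu hv))).le
  calc gue n k {x | 10 < ‖Matrix.toEuclideanCLM (n := Fin k) (𝕜 := ℂ) (x.mat i)‖}
      ≤ ∑ p ∈ N ×ˢ N, gue n k {x | 5 ≤ l p.1 p.2 x} :=
        (measure_mono hsub).trans (measure_biUnion_finset_le _ _)
    _ ≤ ∑ p ∈ N ×ˢ N, ENNReal.ofReal (Real.exp (-(k * 5 ^ 2 / 2))) := by
        refine Finset.sum_le_sum fun p hp => ?_
        obtain ⟨h1, h2⟩ := Finset.mem_product.1 hp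
        exact gaussianMeasure_le_of_abs_le_norm hk0 (by norm_num) _ (hl _ h1 _ h2)
    _ = ENNReal.ofReal ((N.card : ℝ) * N.card * Real.exp (-(k * 5 ^ 2 / 2))) := by
        rw [Finset.sum_const, Finset.card_product, nsmul_eq_mul, ENNReal.ofReal_mul (by positivity),
          ← Nat.cast_mul, ENNReal.ofReal_natCast]
    _ ≤ ENNReal.ofReal (9 ^ (2 * k) * 9 ^ (2 * k) * Real.exp (-(k * 5 ^ 2 / 2))) := by
        norm_num at hcard
        gcongr
    _ = ENNReal.ofReal (6561 * Real.exp (-(25 / 2))) ^ k := by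
        rw [← ENNReal.ofReal_pow (by positivity), mul_pow, ← Real.exp_nat_mul, ← pow_add,
          show 2 * k + 2 * k = 4 * k by ring, pow_mul]
        congr 2
        · norm_num
        · congr 1
          ring

/-- The matrices of the Gaussian unitary ensemble have operator norm at most `10` with high
probability. -/
theorem tendsto_gue_opNorm (i : Fin n) :
    Tendsto (fun k => gue n k {x | 10 < ‖Matrix.toEuclideanCLM (n := Fin k) (𝕜 := ℂ) (x.mat i)‖})
      atTop (𝓝 0) := by
  have h1 : 6561 * Real.exp (-(25 / 2)) < 1 := by
    rw [Real.exp_neg, ← div_eq_mul_inv, div_lt_one (Real.exp_pos _)]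
    calc (6561 : ℝ) < 2.7 ^ 12 := by norm_num
      _ ≤ Real.exp 1 ^ 12 := by
          gcongr
          linarith [Real.exp_one_gt_d9]
      _ = Real.exp 12 := by rw [← Real.exp_nat_mul]; norm_num
      _ ≤ Real.exp (25 / 2) := Real.exp_le_exp.2 (by norm_num)
  have h2 := ENNReal.tendsto_pow_atTop_nhds_zero_of_lt_one
    (r := ENNReal.ofReal (6561 * Real.exp (-(25 / 2)))) (ENNReal.ofReal_lt_one.2 h1)
  refine tendsto_of_tendsto_of_tendsto_of_le_of_le' tendsto_const_nhds h2
    (Eventually.of_forall fun _ => zero_le) ?_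
  filter_upwards [eventually_ge_atTop 1] with k hk
  exact gue_opNorm_le hk i

/-! ### Concentration of traces and the free entropy of semicircular families -/

theorem conjTranspose_word (x : HermTuple n k) (w : List (Fin n)) :
    (x.word w).conjTranspose = x.word w.reverse := by
  induction w with
  | nil => simp
  | cons i w ih =>
    rw [word_cons, Matrix.conjTranspose_mul, ih, conjTranspose_mat, List.reverse_cons, word_append,
      word_cons, word_nil, mul_one]

theorem conj_normTrace_word (x : HermTuple n k) (w : List (Fin n)) :
    star (normTrace (x.word w)) = normTrace (x.word w.reverse) := by
  rw [normTrace, star_div₀, ← Matrix.trace_conjTranspose, conjTranspose_word, normTrace]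
  simp

/-- Traces of words converge in mean square, because the expectations of `tr W` and `tr W * tr W*`
converge to `τ W` and `τ W * τ W*`. -/
theorem tendsto_integral_normTrace_sub_sq {τ : List (Fin n) → ℂ} (h0 : τ [] = 1)
    (hτ : ∀ i w, τ (i :: w) = splitSum i w fun u v => τ u * τ v) (w : List (Fin n)) :
    Tendsto (fun k : ℕ => ∫ x, ‖normTrace (x.word w) - τ w‖ ^ 2 ∂gue n k) atTop (𝓝 0) := by
  have hlim := fun L => tendsto_integral_trProd h0 hτ L
  have h1 : ∀ w : List (Fin n), Tendsto (fun k : ℕ => ∫ x : HermTuple n k, normTrace (x.word w)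
      ∂gue n k) atTop (𝓝 (τ w)) := fun w => by
    simpa [trProd_cons] using hlim [w]
  have h2 : Tendsto (fun k : ℕ => ∫ x : HermTuple n k, normTrace (x.word w) *
      normTrace (x.word w.reverse) ∂gue n k) atTop (𝓝 (τ w * τ w.reverse)) := by
    simpa [trProd_cons] using hlim [w, w.reverse]
  -- The limits of the expectations inherit this symmetry from the matrices.
  have hstar : τ w.reverse = star (τ w) := by
    refine tendsto_nhds_unique (h1 w.reverse) (((h1 w).star).congr fun k => ?_)
    simp only [← conj_normTrace_word]
    exact integral_conj.symm
  have h3 : Tendsto (fun k : ℕ => ∫ x : HermTuple n k, normTrace (x.word w) *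
      normTrace (x.word w.reverse) ∂gue n k - star (τ w) * ∫ x : HermTuple n k,
      normTrace (x.word w) ∂gue n k - τ w * ∫ x : HermTuple n k,
      normTrace (x.word w.reverse) ∂gue n k + τ w * star (τ w)) atTop (𝓝 0) := by
    have := (((h2.sub ((h1 w).const_mul (star (τ w)))).sub
      ((h1 w.reverse).const_mul (τ w))).add_const (τ w * star (τ w)))
    rw [hstar] at this
    convert this using 2
    ring
  have h4 := (Complex.continuous_re.tendsto _).comp h3
  refine h4.congr' ?_
  filter_upwards [eventually_ge_atTop 1] with k hk
  have hk0 : (0 : ℝ) < k := by exact_mod_cast hk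
  have := isProbabilityMeasure_gaussianMeasure (E := HermTuple n k) hk0
  have hp := fun w => polyGrowth_normTrace_word (n := n) (k := k) w
  have e : ∀ x : HermTuple n k, ((‖normTrace (x.word w) - τ w‖ ^ 2 : ℝ) : ℂ) =
      normTrace (x.word w) * normTrace (x.word w.reverse) - star (τ w) * normTrace (x.word w) -
        τ w * normTrace (x.word w.reverse) + τ w * star (τ w) := by
    intro x
    rw [← conj_normTrace_word, Complex.ofReal_pow, ← Complex.mul_conj', ← Complex.star_def,
      star_sub]
    ring
  have e2 : ((∫ x : HermTuple n k, ‖normTrace (x.word w) - τ w‖ ^ 2 ∂gue n k : ℝ) : ℂ) =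
      ∫ x : HermTuple n k, normTrace (x.word w) *
      normTrace (x.word w.reverse) ∂gue n k - star (τ w) * ∫ x : HermTuple n k,
      normTrace (x.word w) ∂gue n k - τ w * ∫ x : HermTuple n k,
      normTrace (x.word w.reverse) ∂gue n k + τ w * star (τ w) := by
    rw [← integral_complex_ofReal]
    simp only [e]
    have i1 := ((hp w).mul (hp w.reverse)).integrable hk0
    have i2 := ((hp w).integrable hk0).const_mul (star (τ w))
    have i3 := ((hp w.reverse).integrable hk0).const_mul (τ w)
    have i12 : Integrable (fun x : HermTuple n k => normTrace (x.word w) *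
      normTrace (x.word w.reverse) - star (τ w) * normTrace (x.word w)) (gue n k) := i1.sub i2
    have i123 : Integrable (fun x : HermTuple n k => normTrace (x.word w) *
      normTrace (x.word w.reverse) - star (τ w) * normTrace (x.word w) -
        τ w * normTrace (x.word w.reverse)) (gue n k) := i12.sub i3
    rw [integral_add i123 (integrable_const _), integral_sub i12 i3, integral_sub i1 i2,
      integral_const_mul, integral_const_mul]
    simp
  simp only [Function.comp_apply]
  rw [← e2, Complex.ofReal_re]

/-- Traces of words in Gaussian random matrices converge in probability. -/
theorem tendsto_gue_normTrace {τ : List (Fin n) → ℂ} (h0 : τ [] = 1)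
    (hτ : ∀ i w, τ (i :: w) = splitSum i w fun u v => τ u * τ v) (w : List (Fin n)) {γ : ℝ}
    (hγ : 0 < γ) :
    Tendsto (fun k => gue n k {x | γ ≤ ‖normTrace (x.word w) - τ w‖}) atTop (𝓝 0) := by
  have h1 := (ENNReal.tendsto_ofReal
    ((tendsto_integral_normTrace_sub_sq h0 hτ w).div_const (γ ^ 2)))
  rw [zero_div, ENNReal.ofReal_zero] at h1
  refine tendsto_of_tendsto_of_tendsto_of_le_of_le' tendsto_const_nhds h1
    (Eventually.of_forall fun _ => zero_le) ?_
  filter_upwards [eventually_ge_atTop 1] with k hk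
  have hk0 : (0 : ℝ) < k := by exact_mod_cast hk
  have := isProbabilityMeasure_gaussianMeasure (E := HermTuple n k) hk0
  have hp : PolyGrowth fun x : HermTuple n k => normTrace (x.word w) - τ w := by
    simpa [sub_eq_add_neg] using (polyGrowth_normTrace_word w).add (.const (-τ w))
  have hint : Integrable (fun x : HermTuple n k => ‖normTrace (x.word w) - τ w‖ ^ 2) (gue n k) := by
    refine ((hp.mul hp).integrable hk0).norm.congr (Eventually.of_forall fun x => ?_)
    simp only [← sq, norm_pow]
  have h2 := mul_meas_ge_le_integral_of_nonneg (Eventually.of_forall fun x => by positivity) hint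
    (γ ^ 2)
  have e : {x : HermTuple n k | γ ≤ ‖normTrace (x.word w) - τ w‖} =
      {x | γ ^ 2 ≤ ‖normTrace (x.word w) - τ w‖ ^ 2} := by
    ext x
    exact (pow_le_pow_iff_left₀ hγ.le (norm_nonneg _) two_ne_zero).symm
  rw [e, ← ofReal_measureReal]
  refine ENNReal.ofReal_le_ofReal ?_
  rw [le_div_iff₀ (by positivity), mul_comm]
  exact h2

end HermTuple

section Semicircular

variable {A : Type*} [Ring A] [Algebra ℂ A] [StarRing A] {φ : A →ₗ[ℂ] ℂ} {n : ℕ} {s : Fin n → A}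

open HermTuple

/-- Gaussian random matrices are microstates of a free semicircular family with high
probability. -/
theorem IsFreeSemicircularFamily.tendsto_gue_compl_microstates
    (hs : IsFreeSemicircularFamily φ s) (h1 : φ 1 = 1) (m : ℕ) {γ : ℝ} (hγ : 0 < γ) :
    Tendsto (fun k => gue n k (microstates φ s 10 m k γ)ᶜ) atTop (𝓝 0) := by
  let τ : List (Fin n) → ℂ := fun w => φ (w.map s).prod
  have h0 : τ [] = 1 := by simpa [τ] using h1
  have hτ : ∀ i w, τ (i :: w) = splitSum i w fun u v => τ u * τ v := hs.schwingerDyson h1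
  have hlim : Tendsto (fun k => ∑ i : Fin n,
      gue n k {x | 10 < ‖Matrix.toEuclideanCLM (n := Fin k) (𝕜 := ℂ) (x.mat i)‖} +
      ∑ p ∈ Finset.range (m + 1), ∑ w : Fin p → Fin n,
        gue n k {x | γ ≤ ‖normTrace (x.word (List.ofFn w)) - τ (List.ofFn w)‖}) atTop (𝓝 0) := by
    have := (tendsto_finsetSum Finset.univ fun i (_ : i ∈ Finset.univ) =>
      tendsto_gue_opNorm (n := n) i).add
      (tendsto_finsetSum (Finset.range (m + 1)) fun p _ =>
        tendsto_finsetSum Finset.univ fun (w : Fin p → Fin n) _ =>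
          tendsto_gue_normTrace h0 hτ (List.ofFn w) hγ)
    simpa using this
  refine tendsto_of_tendsto_of_tendsto_of_le_of_le tendsto_const_nhds hlim
    (fun _ => zero_le) fun k => ?_
  have hsub : (microstates φ s 10 m k γ)ᶜ ⊆
      (⋃ i ∈ (Finset.univ : Finset (Fin n)),
        {x | 10 < ‖Matrix.toEuclideanCLM (n := Fin k) (𝕜 := ℂ) (x.mat i)‖}) ∪
      ⋃ p ∈ Finset.range (m + 1), ⋃ w ∈ (Finset.univ : Finset (Fin p → Fin n)),
        {x | γ ≤ ‖normTrace (x.word (List.ofFn w)) - τ (List.ofFn w)‖} := by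
    intro x hx
    by_contra hnot
    simp only [Set.mem_union, Set.mem_iUnion, Set.mem_ofPred_eq, not_or, not_exists, not_le,
      not_lt] at hnot
    refine hx ⟨fun i => hnot.1 i (Finset.mem_univ i), fun p _ hp w => ?_⟩
    have := hnot.2 p (Finset.mem_range.2 (by omega)) w (Finset.mem_univ w)
    simpa [τ, word, List.map_ofFn, Function.comp_def] using this
  refine (measure_mono hsub).trans ((measure_union_le _ _).trans (add_le_add
    (measure_biUnion_finset_le _ _) ((measure_biUnion_finset_le _ _).trans
      (Finset.sum_le_sum fun p _ => measure_biUnion_finset_le _ _))))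

/-- A set of Gaussian probability at least `1 / 2` has large volume. -/
theorem neg_log_two_le_of_gue {k : ℕ} (hk : 1 ≤ k) {S : Set (HermTuple n k)}
    (hS : ENNReal.ofReal (1 / 2) ≤ gue n k S) :
    ((-Real.log 2 : ℝ) : EReal) ≤
      ((((k : ℝ) ^ 2)⁻¹ : ℝ) : EReal) * ENNReal.log (volume S) +
        (((n : ℝ) / 2 * Real.log k : ℝ) : EReal) := by
  have hk0 : (0 : ℝ) < k := by exact_mod_cast hk
  have hk2 : (0 : EReal) ≤ ((((k : ℝ) ^ 2)⁻¹ : ℝ) : EReal) := by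
    exact_mod_cast (by positivity : (0 : ℝ) ≤ ((k : ℝ) ^ 2)⁻¹)
  have h1 := mul_le_mul_of_nonneg_left
    (ENNReal.log_monotone (hS.trans (gaussianMeasure_le hk0 S))) hk2
  rw [ENNReal.log_mul_add, EReal.left_distrib_of_nonneg_of_ne_top hk2 (EReal.coe_ne_top _),
    ENNReal.log_ofReal_of_pos (by norm_num), ENNReal.log_ofReal_of_pos (by positivity),
    Real.log_rpow (by positivity), finrank_eq, ← EReal.coe_mul, ← EReal.coe_mul] at h1
  have e : ((k : ℝ) ^ 2)⁻¹ * (-(((n * k ^ 2 : ℕ) : ℝ) / 2) * Real.log (2 * Real.pi / k)) =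
      n / 2 * Real.log k - n / 2 * Real.log (2 * Real.pi) := by
    rw [Real.log_div (by positivity) hk0.ne']
    push_cast
    field_simp
    ring
  rw [e] at h1
  have h2 : -Real.log 2 ≤ ((k : ℝ) ^ 2)⁻¹ * Real.log (1 / 2) := by
    rw [one_div, Real.log_inv]
    have h3 : ((k : ℝ) ^ 2)⁻¹ ≤ 1 := inv_le_one_of_one_le₀ (one_le_pow₀ (by exact_mod_cast hk))
    nlinarith [Real.log_nonneg one_le_two]
  have h4 : 0 ≤ n / 2 * Real.log (2 * Real.pi) :=
    mul_nonneg (by positivity) (Real.log_nonneg (by linarith [Real.pi_gt_three]))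
  refine (EReal.coe_le_coe_iff.2 h2).trans (h1.trans ?_)
  rw [add_comm]
  gcongr
  linarith

/-- A free semicircular family has finite free entropy. -/
theorem IsFreeSemicircularFamily.bot_lt_freeEntropy (hs : IsFreeSemicircularFamily φ s)
    (h1 : φ 1 = 1) : ⊥ < freeEntropy φ s := by
  refine (EReal.bot_lt_coe (-Real.log 2)).trans_le
    (le_iSup₂_of_le 10 (by norm_num) (le_iInf fun m => le_iInf₂ fun γ hγ => ?_))
  have hlim := (limsup_const (f := (atTop : Filter ℕ)) ((-Real.log 2 : ℝ) : EReal)).symm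
  refine hlim.le.trans (limsup_le_limsup ?_)
  have hev := (hs.tendsto_gue_compl_microstates h1 m hγ).eventually_lt_const
    (ENNReal.ofReal_pos.2 (by norm_num : (0 : ℝ) < 1 / 2))
  filter_upwards [eventually_ge_atTop 1, hev] with k hk hlt
  refine neg_log_two_le_of_gue hk ?_
  have := isProbabilityMeasure_gaussianMeasure (E := HermTuple n k) (c := k) (by exact_mod_cast hk)
  have h2 : (1 : ENNReal) ≤ gue n k (microstates φ s 10 m k γ) +
      gue n k (microstates φ s 10 m k γ)ᶜ := by
    rw [← measure_univ (μ := gue n k), ← Set.union_compl_self (microstates φ s 10 m k γ)]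
    exact measure_union_le _ _
  by_contra! hcon
  refine absurd h2 (not_le.2 ((ENNReal.add_lt_add hcon hlt).trans_eq ?_))
  rw [← ENNReal.ofReal_add (by norm_num) (by norm_num)]
  norm_num

end Semicircular

theorem corollary3p8 {H : Type*} [NormedAddCommGroup H] [InnerProductSpace ℂ H] [CompleteSpace H]
    (M : VonNeumannAlgebra H) (φ : M.toStarSubalgebra →ₗ[ℂ] ℂ) (hφ : IsNormalTracialState M φ)
    (n : ℕ) :
    (∀ z : Fin n → M.toStarSubalgebra, (∀ i, IsSelfAdjoint (z i)) → ⊥ < freeEntropy φ z →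
      IsFreeHausdorffSet φ z n ∧ freeHausdorffDim φ z = ((n : ℝ) : EReal)) ∧
    (∀ s : Fin n → M.toStarSubalgebra, IsFreeSemicircularFamily φ s →
      ⊥ < freeEntropy φ s ∧ IsFreeHausdorffSet φ s n ∧
        freeHausdorffDim φ s = ((n : ℝ) : EReal)) := by
  refine ⟨fun z _ h => ⟨isFreeHausdorffSet_of_freeEntropy h, freeHausdorffDim_of_freeEntropy h⟩,
    fun s hs => ?_⟩
  have h := hs.bot_lt_freeEntropy hφ.map_one
  exact ⟨h, isFreeHausdorffSet_of_freeEntropy h, freeHausdorffDim_of_freeEntropy h⟩
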